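/- **Setting.** Consider a balanced ANOVA model with a fixed factor $A$ and at most two further factors, called $B,C$ (crossed with $A$ or nested in $A$) or $U,V$ (factors that $A$ is nested in), with numbers of levels $a\ge 2$ and $b,c,u,v\ge 1$, and $n\ge 1$ replicates per cell. $P\times Q$ means crossed with interaction, $P\succ Q$ means that $Q$ is nested in $P$, and bold letters denote random factors. The terms of the model correspond to the non-empty sets $D$ of factors that contain, with a factor, all factors it is nested in. A factor of $D$ is *live* in $D$ if no other factor of $D$ is nested in it. A term has random effects if one of its live factors is random, and fixed (non-random) effects otherwise. An observation is the sum of a general mean, one effect for each term $D$ (whose subscripts are the levels of the factors in $D$), and an error. **Assumptions.** (i) The effects of each fixed term sum to zero over the levels of each of its live factors. (ii) The random effects of a term $D$ are jointly normal with mean zero and covariance $$\operatorname{Cov}(x_i,x_{i'})=\sigma_D^2\prod_{f\in D}\bigl(\mathbf 1[i_f=i'_f]-\rho_{D,f}\bigr),\qquad \sigma_D^2\ge 0,$$ where $\rho_{D,f}=0$ unless $f$ is a live fixed factor of $D$. For such $f$, $\rho_{D,f}$ is a constant (compound symmetry; the value $0$ means independent effects, and $1/(\text{number of levels of } f)$ means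 zero sum over the levels of $f$). If $D$ contains $A$ and $f\neq A$ is live and fixed in $D$, then $\rho_{D,f}=1/(\text{number of levels of } f)$; that is, random interactions with $A$ sum to zero over the levels of the other live fixed factors. (iii) The errors are independent $N(0,\sigma^2)$; the random effects of different terms are mutually independent, and they are independent of the errors. Write $\alpha$ for the effects of $A$, that is $\alpha_i$, $\alpha_{i(j)}$ or $\alpha_{i(jk)}$, where $j$ and $k$ are the levels of $V$ and $U$. Write $\sigma^2_{\alpha,\beta}$, $\sigma^2_{\alpha,\gamma}$, $\sigma^2_{\alpha,\beta,\gamma}$, $\sigma^2_{\nu,\alpha,\beta}$ for the variance components of the terms $\{A,B\}$, $\{A,C\}$, $\{A,B,C\}$, $\{V,A,B\}$. Let $H_0$ be the hypothesis that $A$ has no effect: all levels of $A$ have the same effect, within each combination of levels of the factors that $A$ is nested in. The test statistic is $F_A=MS_A/MS_{\mathrm{den}}$, where $MS$ is the usual mean square (sum of squares divided by its d.f.) of a term, and $MS_{\mathrm{den}}$ is the mean square of the term "den" listed below ("res" stands for the residual mean square). **Theorem.** In each of the following models, if $df_2\ge1$ and $T>0$, then $F_A$ has the noncentral $F$-distribution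 with numerator d.f. $df_1$, denominator d.f. $df_2$ and noncentrality parameter $\lambda=R\,S/T$. Under $H_0$ it has the central $F$-distribution with $df_1,df_2$ d.f., and if $H_0$ is false then $\lambda>0$. *Models without $U,V$*: $df_1=a-1$, $S=\sum_i\alpha_i^2$. | Models | den | $df_2$ | $R$ | $T$ | |---|---|---|---|---| | $A$ | res | $a(n-1)$ | $n$ | $\sigma^2$ | | $A\times B$; $A\succ B$ | res | $ab(n-1)$ | $bn$ | $\sigma^2$ | | $A\times\boldsymbol B$ | $\{A,B\}$ | $(a-1)(b-1)$ | $b$ | $\sigma^2_{\alpha,\beta}+\frac1n\sigma^2$ | | $A\succ\boldsymbol B$ | $\{A,B\}$ | $a(b-1)$ | $b$ | $\sigma^2_{\alpha,\beta}+\frac1n\sigma^2$ | | $A\times B\times C$; $A\succ B\succ C$; $(A\times B)\succ C$; $(A\succ B)\times C$; $A\times(B\succ C)$ | res | $abc(n-1)$ | $bcn$ | $\sigma^2$ | | $A\succ B\succ\boldsymbol C$; $(A\times B)\succ\boldsymbol C$ | $\{A,B,C\}$ | $ab(c-1)$ | $bc$ | $\sigma^2_{\alpha,\beta,\gamma}+\frac1n\sigma^2$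 | | $A\times(B\succ\boldsymbol C)$ | $\{A,B,C\}$ | $(a-1)b(c-1)$ | $bc$ | $\sigma^2_{\alpha,\beta,\gamma}+\frac1n\sigma^2$ | | $(A\succ B)\times\boldsymbol C$ | $\{A,C\}$ | $(a-1)(c-1)$ | $c$ | $\sigma^2_{\alpha,\gamma}+\frac1{bn}\sigma^2$ | | $A\times\boldsymbol B\times C$; $(A\times\boldsymbol B)\succ C$; $A\times(\boldsymbol B\succ C)$ | $\{A,B\}$ | $(a-1)(b-1)$ | $b$ | $\sigma^2_{\alpha,\beta}+\frac1{cn}\sigma^2$ | | $A\succ\boldsymbol B\succ C$; $(A\succ\boldsymbol B)\times C$ | $\{A,B\}$ | $a(b-1)$ | $b$ | $\sigma^2_{\alpha,\beta}+\frac1{cn}\sigma^2$ | | $A\succ\boldsymbol B\succ\boldsymbol C$ | $\{A,B\}$ | $a(b-1)$ | $b$ | $\sigma^2_{\alpha,\beta}+\frac1c\sigma^2_{\alpha,\beta,\gamma}+\frac1{cn}\sigma^2$ | | $(A\times\boldsymbol B)\succ\boldsymbol C$; $A\times(\boldsymbol B\succ\boldsymbol C)$ | $\{A,B\}$ | $(a-1)(b-1)$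 | $b$ | $\sigma^2_{\alpha,\beta}+\frac1c\sigma^2_{\alpha,\beta,\gamma}+\frac1{cn}\sigma^2$ | *Models with $V$ but not $U$*: $df_1=v(a-1)$, $S=\sum_{i,j}\alpha_{i(j)}^2$. | Models | den | $df_2$ | $R$ | $T$ | |---|---|---|---|---| | $V\succ A$; $\boldsymbol V\succ A$ | res | $va(n-1)$ | $n$ | $\sigma^2$ | | $V\succ A\succ B$; $(V\succ A)\times B$; $\boldsymbol V\succ A\succ B$; $(\boldsymbol V\succ A)\times B$ | res | $vab(n-1)$ | $bn$ | $\sigma^2$ | | $V\succ A\succ\boldsymbol B$; $\boldsymbol V\succ A\succ\boldsymbol B$ | $\{V,A,B\}$ | $va(b-1)$ | $b$ | $\sigma^2_{\nu,\alpha,\beta}+\frac1n\sigma^2$ | | $(V\succ A)\times\boldsymbol B$; $(\boldsymbol V\succ A)\times\boldsymbol B$ | $\{V,A,B\}$ | $v(a-1)(b-1)$ | $b$ | $\sigma^2_{\nu,\alpha,\beta}+\frac1n\sigma^2$ | *Models with $U,V$*: $df_1=uv(a-1)$, $S=\sum_{i,j,k}\alpha_{i(jk)}^2$. | Models | den | $df_2$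 | $R$ | $T$ | |---|---|---|---|---| | $U\succ V\succ A$; $(U\times V)\succ A$; $\boldsymbol U\succ V\succ A$; $U\succ\boldsymbol V\succ A$; $(U\times\boldsymbol V)\succ A$; $\boldsymbol U\succ\boldsymbol V\succ A$; $(\boldsymbol U\times\boldsymbol V)\succ A$ | res | $uva(n-1)$ | $n$ | $\sigma^2$ | -/

import Mathlib

open MeasureTheory ProbabilityTheory
open scoped NNReal BigOperators

/-- The factors that can occur: `A` is the tested factor, `B`, `C` are crossed with or nested in
`A`, and `A` is nested in `U`, `V`. -/
inductive Factor
  | A | B | C | U | V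
  deriving DecidableEq

open Factor

/-- The classifications, with all factors' nesting and crossing relations.  `P ≻ Q` means that
`Q` is nested in `P`, and `×` means crossed with interaction. -/
inductive Shape
  /-- `A` -/
  | one
  /-- `A × B` -/
  | axb
  /-- `A ≻ B` -/
  | anb
  /-- `V ≻ A` -/
  | vna
  /-- `A × B × C` -/
  | axbxc
  /-- `A ≻ B ≻ C` -/
  | anbnc
  /-- `(A × B) ≻ C` -/
  | axb_nc
  /-- `(A ≻ B) × C` -/
  | anb_xc
  /-- `A × (B ≻ C)` -/
  | ax_bnc
  /-- `V ≻ A ≻ B` -/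
  | vnanb
  /-- `(V ≻ A) × B` -/
  | vna_xb
  /-- `U ≻ V ≻ A` -/
  | unvna
  /-- `(U × V) ≻ A` -/
  | uxv_na

/-- The factors of a classification. -/
def Shape.factors : Shape → Finset Factor
  | .one => {A}
  | .axb | .anb => {A, B}
  | .vna => {V, A}
  | .axbxc | .anbnc | .axb_nc | .anb_xc | .ax_bnc => {A, B, C}
  | .vnanb | .vna_xb => {V, A, B}
  | .unvna | .uxv_na => {U, V, A}

/-- `s.parents f` is the set of all factors that `f` is nested in. -/
def Shape.parents : Shape → Factor → Finset Factor
  | .anb, B => {A}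
  | .vna, A => {V}
  | .anbnc, B => {A}
  | .anbnc, C => {A, B}
  | .axb_nc, C => {A, B}
  | .anb_xc, B => {A}
  | .ax_bnc, C => {B}
  | .vnanb, A => {V}
  | .vnanb, B => {V, A}
  | .vna_xb, A => {V}
  | .unvna, V => {U}
  | .unvna, A => {U, V}
  | .uxv_na, A => {U, V}
  | _, _ => ∅

/-- The models of the table.  Letters as in `Shape`; a factor followed by `R` is random, all other
factors are fixed. -/
inductive Model
  /-- `A` -/
  | a
  /-- `A × B` -/
  | axb
  /-- `A ≻ B` -/
  | anb
  /-- `A × 𝐁` -/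
  | axbR
  /-- `A ≻ 𝐁` -/
  | anbR
  /-- `V ≻ A` -/
  | vna
  /-- `𝐕 ≻ A` -/
  | vRna
  /-- `A × B × C` -/
  | axbxc
  /-- `A ≻ B ≻ C` -/
  | anbnc
  /-- `(A × B) ≻ C` -/
  | axb_nc
  /-- `(A ≻ B) × C` -/
  | anb_xc
  /-- `A × (B ≻ C)` -/
  | ax_bnc
  /-- `A ≻ B ≻ 𝐂` -/
  | anbncR
  /-- `(A × B) ≻ 𝐂` -/
  | axb_ncR
  /-- `A × (B ≻ 𝐂)` -/
  | ax_bncR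
  /-- `(A ≻ B) × 𝐂` -/
  | anb_xcR
  /-- `A × 𝐁 × C` -/
  | axbRxc
  /-- `(A × 𝐁) ≻ C` -/
  | axbR_nc
  /-- `A × (𝐁 ≻ C)` -/
  | ax_bRnc
  /-- `A ≻ 𝐁 ≻ C` -/
  | anbRnc
  /-- `(A ≻ 𝐁) × C` -/
  | anbR_xc
  /-- `A ≻ 𝐁 ≻ 𝐂` -/
  | anbRncR
  /-- `(A × 𝐁) ≻ 𝐂` -/
  | axbR_ncR
  /-- `A × (𝐁 ≻ 𝐂)` -/
  | ax_bRncR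
  /-- `V ≻ A ≻ B` -/
  | vnanb
  /-- `(V ≻ A) × B` -/
  | vna_xb
  /-- `𝐕 ≻ A ≻ B` -/
  | vRnanb
  /-- `(𝐕 ≻ A) × B` -/
  | vRna_xb
  /-- `V ≻ A ≻ 𝐁` -/
  | vnanbR
  /-- `𝐕 ≻ A ≻ 𝐁` -/
  | vRnanbR
  /-- `(V ≻ A) × 𝐁` -/
  | vna_xbR
  /-- `(𝐕 ≻ A) × 𝐁` -/
  | vRna_xbR
  /-- `U ≻ V ≻ A` -/
  | unvna
  /-- `(U × V) ≻ A` -/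
  | uxv_na
  /-- `𝐔 ≻ V ≻ A` -/
  | uRnvna
  /-- `U ≻ 𝐕 ≻ A` -/
  | unvRna
  /-- `(U × 𝐕) ≻ A` -/
  | uxvR_na
  /-- `𝐔 ≻ 𝐕 ≻ A` -/
  | uRnvRna
  /-- `(𝐔 × 𝐕) ≻ A` -/
  | uRxvR_na

namespace Model

/-- The classification underlying a model. -/
def shape : Model → Shape
  | a => .one
  | axb | axbR => .axb
  | anb | anbR => .anb
  | vna | vRna => .vna
  | axbxc | axbRxc => .axbxc
  | anbnc | anbncR | anbRnc | anbRncR => .anbnc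
  | axb_nc | axb_ncR | axbR_nc | axbR_ncR => .axb_nc
  | anb_xc | anb_xcR | anbR_xc => .anb_xc
  | ax_bnc | ax_bncR | ax_bRnc | ax_bRncR => .ax_bnc
  | vnanb | vRnanb | vnanbR | vRnanbR => .vnanb
  | vna_xb | vRna_xb | vna_xbR | vRna_xbR => .vna_xb
  | unvna | uRnvna | unvRna | uRnvRna => .unvna
  | uxv_na | uxvR_na | uRxvR_na => .uxv_na

/-- The random factors of a model; all other factors are fixed. -/
def random : Model → Finset Factor
  | a | axb | anb | vna | axbxc | anbnc | axb_nc | anb_xc | ax_bnc | vnanb | vna_xb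
  | unvna | uxv_na => ∅
  | axbR | anbR | axbRxc | axbR_nc | ax_bRnc | anbRnc | anbR_xc
  | vnanbR | vna_xbR => {B}
  | anbncR | axb_ncR | ax_bncR | anb_xcR => {C}
  | anbRncR | axbR_ncR | ax_bRncR => {B, C}
  | vRna | vRnanb | vRna_xb | unvRna | uxvR_na => {V}
  | vRnanbR | vRna_xbR => {V, B}
  | uRnvna => {U}
  | uRnvRna | uRxvR_na => {U, V}

/-- The factors of the model. -/
def factors (M : Model) : Finset Factor := M.shape.factors

/-- All factors that `f` is nested in. -/
def parents (M : Model) (f : Factor) : Finset Factor := M.shape.parents f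

/-- The terms of the model equation (main effects, nested effects and interactions), each one
given by the set of all its subscripts, those of nesting factors included: these are the non-empty
sets of factors that contain with a factor all factors it is nested in. -/
def terms (M : Model) : Finset (Finset Factor) :=
  M.factors.powerset.filter fun D => D.Nonempty ∧ ∀ f ∈ D, M.parents f ⊆ D

/-- The factors of a term which do not nest another factor of the term, i.e. the subscripts that
are usually written outside the parentheses. -/
def live (M : Model) (D : Finset Factor) : Finset Factor :=
  D.filter fun f => ∀ g ∈ D, f ∉ M.parents g

/-- A term has random effects if one of its live factors is random, otherwise the effects are
fixed. -/
def IsRandomTerm (M : Model) (D : Finset Factor) : Prop :=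
  ∃ f ∈ M.live D, f ∈ M.random

instance (M : Model) (D : Finset Factor) : Decidable (M.IsRandomTerm D) := by
  unfold IsRandomTerm; infer_instance

/-- The terms with random effects. -/
def randomTerms (M : Model) : Finset (Finset Factor) :=
  M.terms.filter fun D => M.IsRandomTerm D

/-- The term of the effects of `A`: `α_i`, `α_{i(j)}` or `α_{i(jk)}`. -/
def termA (M : Model) : Finset Factor := insert A (M.parents A)

/-- The term whose mean squares are the denominator of the test statistic; `none` stands for the
residual mean squares. -/
def denominator : Model → Option (Finset Factor)
  | a | axb | anb | vna | vRna | axbxc | anbnc | axb_nc | anb_xc | ax_bnc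
  | vnanb | vna_xb | vRnanb | vRna_xb
  | unvna | uxv_na | uRnvna | unvRna | uxvR_na | uRnvRna | uRxvR_na => none
  | axbR | anbR | axbRxc | axbR_nc | ax_bRnc | anbRnc | anbR_xc
  | anbRncR | axbR_ncR | ax_bRncR => some {A, B}
  | anbncR | axb_ncR | ax_bncR => some {A, B, C}
  | anb_xcR => some {A, C}
  | vnanbR | vRnanbR | vna_xbR | vRna_xbR => some {V, A, B}

end Model

/-- Subscripts of the effects of the term `D`: a level for each factor in `D`. -/
abbrev Idx (lev : Factor → ℕ) (D : Finset Factor) : Type := (f : ↥D) → Fin (lev f)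

/-- The observations of a balanced design: a level for each factor, and the replicate. -/
abbrev Obs (M : Model) (lev : Factor → ℕ) (n : ℕ) : Type := Idx lev M.factors × Fin n

lemma Model.subset_of_mem_terms {M : Model} {D : Finset Factor} (h : D ∈ M.terms) :
    D ⊆ M.factors :=
  Finset.mem_powerset.1 (Finset.mem_filter.1 h).1

noncomputable section

namespace Model

variable (M : Model) (lev : Factor → ℕ) (n : ℕ)

/-! ### The analysis of variance -/

/-- The mean of all observations that have the same levels of the factors in `D` as `o`. -/
def mean (D : Finset Factor) (y : Obs M lev n → ℝ) (o : Obs M lev n) : ℝ :=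
  let s := Finset.univ.filter fun o' : Obs M lev n =>
    ∀ f : ↥M.factors, (f : Factor) ∈ D → o'.1 f = o.1 f
  (∑ o' ∈ s, y o') / (s.card : ℝ)

/-- The least squares estimate of the effect of the term `D`, e.g.
`y_{ij} - y_i - y_j + y` for `D = {A, B}` in `A × B` and `y_{ij} - y_i` in `A ≻ B`, where the
`y` on the right are means. -/
def estimate (D : Finset Factor) (y : Obs M lev n → ℝ) (o : Obs M lev n) : ℝ :=
  ∑ K ∈ (M.live D).powerset, (-1 : ℝ) ^ K.card * M.mean lev n (D \ K) y o

/-- The sum of squares of the term `D`. -/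
def sumSq (D : Finset Factor) (y : Obs M lev n → ℝ) : ℝ :=
  ∑ o, M.estimate lev n D y o ^ 2

/-- The degrees of freedom of the sum of squares of the term `D`. -/
def dof (D : Finset Factor) : ℕ :=
  ∏ f ∈ D, if f ∈ M.live D then lev f - 1 else lev f

/-- The mean squares of the term `D`. -/
def meanSq (D : Finset Factor) (y : Obs M lev n → ℝ) : ℝ :=
  M.sumSq lev n D y / (M.dof lev D : ℝ)

/-- The residual mean squares. -/
def residualMeanSq (y : Obs M lev n → ℝ) : ℝ :=
  (∑ o, (y o - M.mean lev n M.factors y o) ^ 2) /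
    (((∏ f ∈ M.factors, lev f) * (n - 1) : ℕ) : ℝ)

/-- The test statistic `F_A`: the mean squares of `A` divided by those of the denominator. -/
def testStatistic (y : Obs M lev n → ℝ) : ℝ :=
  M.meanSq lev n M.termA y /
    match M.denominator with
    | none => M.residualMeanSq lev n y
    | some D => M.meanSq lev n D y

/-! ### The model equation and its assumptions -/

variable {M lev n} in
/-- The response of the observation `o`: the general mean `μ`, plus one effect for each term
(`θ` holds the fixed effects, `X` the random ones), plus the error. -/
def response {Ω : Type*} (μ : ℝ) (θ : (D : Finset Factor) → Idx lev D → ℝ)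
    (X : (D : Finset Factor) → Idx lev D → Ω → ℝ) (ε : Obs M lev n → Ω → ℝ)
    (ω : Ω) (o : Obs M lev n) : ℝ :=
  μ + (∑ D ∈ M.terms.attach,
      let i : Idx lev D.1 := fun f => o.1 ⟨f, Model.subset_of_mem_terms D.2 f.2⟩
      if M.IsRandomTerm D.1 then X D.1 i ω else θ D.1 i)
    + ε o ω

/-- Covariance of the random effects with subscripts `i`, `i'` of the term `D`, for the variance
component `s`.  Over random factors and over nesting factors the effects are independent.
Over a live fixed factor `f` they are compound symmetric with a parameter `ρ f`:
`ρ f = 0` gives independence, and `ρ f = 1 / lev f` gives effects with zero sum over the levels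
of `f`. -/
def effectCov (D : Finset Factor) (s : ℝ) (ρ : Factor → ℝ) (i i' : Idx lev D) : ℝ :=
  s * ∏ f : ↥D, ((if i f = i' f then 1 else 0)
    - if (f : Factor) ∈ M.live D ∧ (f : Factor) ∉ M.random then ρ f else 0)

/-- The assumptions on the effects and errors.  `σ2 D` is the variance component of the random
term `D`, and `σ2e` is the error variance. -/
structure Assumptions {Ω : Type*} [MeasurableSpace Ω] (P : Measure Ω)
    (σ2 : Finset Factor → ℝ≥0) (σ2e : ℝ≥0) (ρ : Finset Factor → Factor → ℝ)
    (θ : (D : Finset Factor) → Idx lev D → ℝ)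
    (X : (D : Finset Factor) → Idx lev D → Ω → ℝ) (ε : Obs M lev n → Ω → ℝ) : Prop where
  /-- Identifiability of fixed effects: zero sum over the levels of each live factor. -/
  fixed_sum : ∀ D ∈ M.terms, ¬ M.IsRandomTerm D → ∀ f : ↥D, (f : Factor) ∈ M.live D →
    ∀ i : Idx lev D, ∑ l : Fin (lev f), θ D (Function.update i f l) = 0
  /-- Restriction of the random interactions that involve `A`: zero sum over the levels of each
  live fixed factor other than `A`. -/
  restricted : ∀ D ∈ M.randomTerms, A ∈ D → ∀ f ∈ M.live D, f ∉ M.random → f ≠ A →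
    ρ D f = 1 / (lev f : ℝ)
  /-- The effects of a random term are jointly normal. -/
  normal : ∀ D ∈ M.randomTerms, HasGaussianLaw (fun ω i => X D i ω) P
  mean_zero : ∀ D ∈ M.randomTerms, ∀ i, ∫ ω, X D i ω ∂P = 0
  covariance : ∀ D ∈ M.randomTerms, ∀ i i',
    ProbabilityTheory.covariance (X D i) (X D i') P = M.effectCov lev D (σ2 D) (ρ D) i i'
  /-- The errors are normal with mean zero and equal variances. -/
  error_law : ∀ o, HasLaw (ε o) (gaussianReal 0 σ2e) P
  /-- The errors are mutually independent. -/
  error_indep : iIndepFun ε P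
  /-- The effects of different random terms are mutually independent. -/
  effects_indep : iIndepFun (fun (D : ↥M.randomTerms) ω i => X D.1 i ω) P
  /-- The random effects are independent of the errors. -/
  effects_error_indep :
    IndepFun (fun ω (D : ↥M.randomTerms) i => X D.1 i ω) (fun ω o => ε o ω) P

variable {M lev} in
/-- The null hypothesis that `A` has no effect: all levels of `A` have the same effect (within
each combination of levels of the factors that `A` is nested in). -/
def NoEffect (α : Idx lev M.termA → ℝ) : Prop :=
  ∀ i i' : Idx lev M.termA, (∀ f : ↥M.termA, (f : Factor) ≠ A → i f = i' f) → α i = α i'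

/-! ### The table -/

/-- Numerator degrees of freedom. -/
def df1 : ℕ :=
  match M with
  | a | axb | anb | axbR | anbR
  | axbxc | anbnc | axb_nc | anb_xc | ax_bnc | anbncR | axb_ncR | ax_bncR | anb_xcR
  | axbRxc | axbR_nc | ax_bRnc | anbRnc | anbR_xc | anbRncR | axbR_ncR | ax_bRncR => lev A - 1
  | vna | vRna | vnanb | vna_xb | vRnanb | vRna_xb
  | vnanbR | vRnanbR | vna_xbR | vRna_xbR => lev V * (lev A - 1)
  | unvna | uxv_na | uRnvna | unvRna | uxvR_na | uRnvRna | uRxvR_na =>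
      lev U * lev V * (lev A - 1)

/-- Denominator degrees of freedom. -/
def df2 : ℕ :=
  match M with
  | a => lev A * (n - 1)
  | axb | anb => lev A * lev B * (n - 1)
  | axbR => (lev A - 1) * (lev B - 1)
  | anbR => lev A * (lev B - 1)
  | vna | vRna => lev V * lev A * (n - 1)
  | axbxc | anbnc | axb_nc | anb_xc | ax_bnc => lev A * lev B * lev C * (n - 1)
  | anbncR | axb_ncR => lev A * lev B * (lev C - 1)
  | ax_bncR => (lev A - 1) * lev B * (lev C - 1)
  | anb_xcR => (lev A - 1) * (lev C - 1)
  | axbRxc | axbR_nc | ax_bRnc => (lev A - 1) * (lev B - 1)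
  | anbRnc | anbR_xc | anbRncR => lev A * (lev B - 1)
  | axbR_ncR | ax_bRncR => (lev A - 1) * (lev B - 1)
  | vnanb | vna_xb | vRnanb | vRna_xb => lev V * lev A * lev B * (n - 1)
  | vnanbR | vRnanbR => lev V * lev A * (lev B - 1)
  | vna_xbR | vRna_xbR => lev V * (lev A - 1) * (lev B - 1)
  | unvna | uxv_na | uRnvna | unvRna | uxvR_na | uRnvRna | uRxvR_na =>
      lev U * lev V * lev A * (n - 1)

/-- The factor `R` of the noncentrality parameter. -/
def R : ℕ :=
  match M with
  | a | vna | vRna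
  | unvna | uxv_na | uRnvna | unvRna | uxvR_na | uRnvRna | uRxvR_na => n
  | axb | anb | vnanb | vna_xb | vRnanb | vRna_xb => lev B * n
  | axbxc | anbnc | axb_nc | anb_xc | ax_bnc => lev B * lev C * n
  | anbncR | axb_ncR | ax_bncR => lev B * lev C
  | anb_xcR => lev C
  | axbR | anbR | axbRxc | axbR_nc | ax_bRnc | anbRnc | anbR_xc
  | anbRncR | axbR_ncR | ax_bRncR
  | vnanbR | vRnanbR | vna_xbR | vRna_xbR => lev B

variable {M lev} in
/-- The sum of squares `S` of the effects of `A`. -/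
def S (α : Idx lev M.termA → ℝ) : ℝ := ∑ i, α i ^ 2

/-- The weighted sum `T` of variance components. -/
def T (σ2 : Finset Factor → ℝ≥0) (σ2e : ℝ≥0) : ℝ :=
  match M with
  | a | axb | anb | vna | vRna | axbxc | anbnc | axb_nc | anb_xc | ax_bnc
  | vnanb | vna_xb | vRnanb | vRna_xb
  | unvna | uxv_na | uRnvna | unvRna | uxvR_na | uRnvRna | uRxvR_na => σ2e
  | axbR | anbR => σ2 {A, B} + 1 / (n : ℝ) * σ2e
  | anbncR | axb_ncR | ax_bncR => σ2 {A, B, C} + 1 / (n : ℝ) * σ2e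
  | anb_xcR => σ2 {A, C} + 1 / (lev B * n : ℝ) * σ2e
  | axbRxc | axbR_nc | ax_bRnc | anbRnc | anbR_xc => σ2 {A, B} + 1 / (lev C * n : ℝ) * σ2e
  | anbRncR | axbR_ncR | ax_bRncR =>
      σ2 {A, B} + 1 / (lev C : ℝ) * σ2 {A, B, C} + 1 / (lev C * n : ℝ) * σ2e
  | vnanbR | vRnanbR | vna_xbR | vRna_xbR => σ2 {V, A, B} + 1 / (n : ℝ) * σ2e

variable {M lev} in
/-- The noncentrality parameter `λ = R S / T` of the table. -/
def noncentrality (α : Idx lev M.termA → ℝ) (σ2 : Finset Factor → ℝ≥0) (σ2e : ℝ≥0) : ℝ :=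
  (M.R lev n : ℝ) * S α / M.T lev n σ2 σ2e

end Model

/-! ### Chi-squared and `F` distributions -/

/-- The central chi-squared distribution: the law of the sum of squares of `k` independent
standard normal variables. -/
def chiSq (k : ℕ) : Measure ℝ :=
  (Measure.pi fun _ : Fin k => gaussianReal 0 1).map fun z => ∑ i, z i ^ 2

/-- The noncentral chi-squared distribution with `k ≥ 1` degrees of freedom and noncentrality
parameter `l ≥ 0`: the law of the sum of squares of `k` independent normal variables with unit
variances, whose vector of means has squared length `l`. -/
def noncentralChiSq (k : ℕ) (l : ℝ) : Measure ℝ :=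
  (Measure.pi fun i : Fin k => gaussianReal (if (i : ℕ) = 0 then √l else 0) 1).map
    fun z => ∑ i, z i ^ 2

/-- The law of `(X / d₁) / (Y / d₂)` for independent `X ∼ χ²(d₁)`, `Y ∼ χ²(d₂)`. -/
def centralF (d₁ d₂ : ℕ) : Measure ℝ :=
  ((chiSq d₁).prod (chiSq d₂)).map fun p => (p.1 / (d₁ : ℝ)) / (p.2 / (d₂ : ℝ))

/-- The law of `(X / d₁) / (Y / d₂)` for independent `X ∼ χ²(d₁, l)`, `Y ∼ χ²(d₂)`. -/
def noncentralF (d₁ d₂ : ℕ) (l : ℝ) : Measure ℝ :=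
  ((noncentralChiSq d₁ l).prod (chiSq d₂)).map fun p => (p.1 / (d₁ : ℝ)) / (p.2 / (d₂ : ℝ))

end

/-!
The proof is the classical orthogonal decomposition of a balanced layout. An observation vector
lives in a tensor product of the spaces `ℝ^(lev f)`, one for each factor `f`, and of `ℝ^n` for the
replicates. On each tensor factor only the matrices that act as a scalar `a` on zero-sum vectors and
as a scalar `b` on constant vectors occur (`levelKernel`), and their tensor products
(`Model.kernel`) multiply weight by weight. All matrices of the problem are of this form:

* taking estimates of the effects of a term `E` is the projection `Model.proj`
  (`Model.estimate_eq_proj`), and taking residuals is the projection `Model.residualProj`;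
* a random term induces a multiple of a `kernel` as covariance matrix
  (`Model.effectCov_eq_kernel`).

So different projections are orthogonal, and the range of each projection onto a term containing `A`
consists of eigenvectors of the covariance matrix of the observations (`Model.covMatrix_mul_proj`):
a random term `D` contributes to the eigenvalue of `E` only if `E ⊆ D` and no live fixed factor of
`D` lies outside `E`, since over such a factor the effects sum to zero. The denominator of the table
is the projection for which exactly the same random terms contribute as for `A`
(`Model.denominator_spec`, `Model.contributing_termA_eq_empty`), so both have the same eigenvalue,
which is the value `T` of the table up to a known factor (`Model.eigenvalue_termA_mul_R`). Fixed
effects of a term lie in the range of the projection onto that term (`Model.proj_mulVec_effect`), so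
the numerator projection maps the mean to the effects of `A` and the denominator projection kills
it.

The distribution follows from a general fact on Gaussian vectors
(`hasLaw_noncentralF_of_gaussian`): in orthonormal bases of the two ranges, the first one chosen with
its first vector along the projected mean, the coordinates are independent normal variables with
equal variances.
-/

/-! ### Ratios of quadratic forms in Gaussian vectors -/

lemma finrank_range_toEuclideanLin_of_isIdempotent {ι : Type*} [Fintype ι] [DecidableEq ι]
    {Q : Matrix ι ι ℝ} (hQ : Q * Q = Q) {d : ℕ} (hd : Q.trace = d) :
    Module.finrank ℝ (LinearMap.range (Matrix.toEuclideanLin Q)) = d := by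
  have hproj : LinearMap.IsProj (LinearMap.range (Matrix.toEuclideanLin Q))
      (Matrix.toEuclideanLin Q) := by
    refine ⟨fun x => LinearMap.mem_range_self _ x, ?_⟩
    rintro _ ⟨x, rfl⟩
    simp [Matrix.toLpLin_apply, Matrix.mulVec_mulVec, hQ]
  have h1 := hproj.trace
  have h2 : LinearMap.trace ℝ _ (Matrix.toEuclideanLin Q) = Q.trace := by
    change LinearMap.trace ℝ _ (Matrix.toLpLin 2 2 Q) = _
    rw [Matrix.toLpLin_eq_toLin, Matrix.trace_toLin_eq]
  rw [h2, hd] at h1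
  exact_mod_cast h1.symm

/-- The range of an orthogonal projection of rank `d` has an orthonormal basis whose first vector
points in the direction of the projection of a given vector `m`. -/
lemma exists_orthonormal_frame {ι : Type*} [Fintype ι] [DecidableEq ι] {Q : Matrix ι ι ℝ}
    (hsymm : Q.transpose = Q) (hQ : Q * Q = Q) {d : ℕ} (hd : Q.trace = d) (m : ι → ℝ) :
    ∃ u : Fin d → ι → ℝ, (∀ k, Q.mulVec (u k) = u k) ∧
      (∀ k l, u k ⬝ᵥ u l = if k = l then 1 else 0) ∧
      (∀ y, ∑ o, Q.mulVec y o ^ 2 = ∑ k, (u k ⬝ᵥ y) ^ 2) ∧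
      ∀ k, u k ⬝ᵥ m = if (k : ℕ) = 0 then √(∑ o, Q.mulVec m o ^ 2) else 0 := by
  set S := LinearMap.range (Matrix.toEuclideanLin Q) with hS
  have hfin : Module.finrank ℝ S = Fintype.card (Fin d) := by
    rw [Fintype.card_fin]; exact finrank_range_toEuclideanLin_of_isIdempotent hQ hd
  let w : (ι → ℝ) → S := fun y => ⟨WithLp.toLp 2 (Q.mulVec y), WithLp.toLp 2 y, by
    simp [Matrix.toLpLin_apply]⟩
  have hw : ∀ y, ‖w y‖ ^ 2 = ∑ o, Q.mulVec y o ^ 2 := fun y => by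
    rw [Submodule.coe_norm, EuclideanSpace.norm_sq_eq]; simp [w]
  -- if `m` has projection `0`, no basis vector is prescribed
  obtain ⟨b, hb⟩ := Orthonormal.exists_orthonormalBasis_extension_of_card_eq hfin
    (v := fun _ : Fin d => ‖w m‖⁻¹ • w m) (s := {k | (k : ℕ) = 0 ∧ w m ≠ 0}) (by
      constructor
      · rintro ⟨k, hk, h0⟩
        simp only [Set.domRestrict_apply]
        rw [norm_smul, norm_inv, norm_norm, inv_mul_cancel₀ (norm_ne_zero_iff.2 h0)]
      · rintro ⟨k, hk, h0⟩ ⟨l, hl, h0'⟩ hkl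
        exact absurd (Subtype.ext (Fin.ext (hk.trans hl.symm))) hkl)
  have hfix : ∀ k, Q.mulVec (WithLp.ofLp (b k : EuclideanSpace ℝ ι)) = (b k).1.ofLp := by
    intro k
    obtain ⟨x, hx⟩ := (b k).2
    rw [← hx]
    simp [Matrix.toLpLin_apply, Matrix.mulVec_mulVec, hQ]
  have hinner : ∀ k y, (b k).1.ofLp ⬝ᵥ y = inner ℝ (b k) (w y) := by
    intro k y
    rw [Submodule.coe_inner, EuclideanSpace.inner_eq_star_dotProduct]
    simp only [w, star_trivial]
    conv_lhs => rw [← hfix k, ← Matrix.vecMul_transpose, hsymm, ← Matrix.dotProduct_mulVec]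
    exact dotProduct_comm _ _
  refine ⟨fun k => (b k).1.ofLp, hfix, fun k l => ?_, fun y => ?_, fun k => ?_⟩
  · rw [← orthonormal_iff_ite.1 b.orthonormal k l, Submodule.coe_inner,
      EuclideanSpace.inner_eq_star_dotProduct]
    simp [dotProduct_comm]
  · rw [← hw, ← b.sum_sq_norm_inner_right]
    exact Finset.sum_congr rfl fun k _ => by rw [hinner, Real.norm_eq_abs, sq_abs]
  · rw [hinner, ← hw, Real.sqrt_sq (norm_nonneg _)]
    by_cases h0 : w m = 0
    · simp [h0]
    have hk0 : 0 < d := k.pos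
    have hb0 := hb ⟨0, hk0⟩ ⟨rfl, h0⟩
    have hwm : w m = ‖w m‖ • b ⟨0, hk0⟩ := by
      rw [hb0, smul_smul, mul_inv_cancel₀ (norm_ne_zero_iff.2 h0), one_smul]
    have hkm : inner ℝ (b k) (w m) = ‖w m‖ * inner ℝ (b k) (b ⟨0, hk0⟩) := by
      rw [← real_inner_smul_right, ← hwm]
    rw [hkm, orthonormal_iff_ite.1 b.orthonormal]
    simp [Fin.ext_iff]

lemma covariance_dotProduct {Ω ι : Type*} [Fintype ι] [MeasurableSpace Ω] {P : Measure Ω}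
    [IsProbabilityMeasure P] {Y : Ω → ι → ℝ} (hY : ∀ o, MemLp (fun ω => Y ω o) 2 P)
    {V : Matrix ι ι ℝ}
    (hV : ∀ o o', covariance (fun ω => Y ω o) (fun ω => Y ω o') P = V o o') (x z : ι → ℝ) :
    covariance (fun ω => x ⬝ᵥ Y ω) (fun ω => z ⬝ᵥ Y ω) P = x ⬝ᵥ V.mulVec z := by
  simp only [dotProduct, Matrix.mulVec]
  rw [covariance_fun_sum_fun_sum (fun o => (hY o).const_mul _) (fun o => (hY o).const_mul _)]
  refine Finset.sum_congr rfl fun o _ => ?_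
  rw [Finset.mul_sum]
  refine Finset.sum_congr rfl fun o' _ => ?_
  rw [covariance_const_mul_left, covariance_const_mul_right, hV]
  ring

/-- The sums of squares of two uncorrelated white-noise coordinate systems, the first with its mean
along the first coordinate axis and the second centered, are independent chi-squared variables. -/
lemma map_sum_sq_of_gaussian {Ω : Type*} [MeasurableSpace Ω] {P : Measure Ω}
    [IsProbabilityMeasure P] {d₁ d₂ : ℕ} {l : ℝ} {U : Fin d₁ → Ω → ℝ} {W : Fin d₂ → Ω → ℝ}
    (hg : HasGaussianLaw (fun ω => (fun k => U k ω, fun k => W k ω)) P)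
    (hU : ∀ k, ∫ ω, U k ω ∂P = if (k : ℕ) = 0 then √l else 0) (hW : ∀ k, ∫ ω, W k ω ∂P = 0)
    (hUU : ∀ k l, covariance (U k) (U l) P = if k = l then 1 else 0)
    (hWW : ∀ k l, covariance (W k) (W l) P = if k = l then 1 else 0)
    (hUW : ∀ k l, covariance (U k) (W l) P = 0) :
    P.map (fun ω => (∑ k, U k ω ^ 2, ∑ k, W k ω ^ 2)) =
      (noncentralChiSq d₁ l).prod (chiSq d₂) := by
  have hgU : HasGaussianLaw (fun ω k => U k ω) P := hg.fst
  have hgW : HasGaussianLaw (fun ω k => W k ω) P := hg.snd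
  have hlaw : ∀ {Z : Ω → ℝ} {s : ℝ}, HasGaussianLaw Z P → ∫ ω, Z ω ∂P = s →
      covariance Z Z P = 1 → P.map Z = gaussianReal s 1 := by
    intro Z s hZ h1 h2
    rw [hZ.map_eq_gaussianReal, h1, ← covariance_self hZ.aemeasurable, h2, Real.toNNReal_one]
  have hmU : P.map (fun ω k => U k ω) = Measure.pi fun k : Fin d₁ =>
      gaussianReal (if (k : ℕ) = 0 then √l else 0) 1 := by
    have hind : iIndepFun U P := hgU.iIndepFun_of_covariance_eq_zero
      fun k l hkl => by rw [hUU, if_neg hkl]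
    rw [(iIndepFun_iff_map_fun_eq_pi_map (fun k => (hgU.eval k).aemeasurable)).1 hind]
    congr 1
    funext k
    exact hlaw (hgU.eval k) (hU k) (by simpa using hUU k k)
  have hmW : P.map (fun ω k => W k ω) = Measure.pi fun k : Fin d₂ => gaussianReal 0 1 := by
    have hind : iIndepFun W P := hgW.iIndepFun_of_covariance_eq_zero
      fun k l hkl => by rw [hWW, if_neg hkl]
    rw [(iIndepFun_iff_map_fun_eq_pi_map (fun k => (hgW.eval k).aemeasurable)).1 hind]
    congr 1
    funext k
    exact hlaw (hgW.eval k) (hW k) (by simpa using hWW k k)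
  have hpair := (indepFun_iff_map_prod_eq_prod_map_map hgU.aemeasurable hgW.aemeasurable).1
    (hg.indepFun_of_covariance_eval hUW)
  have hmeas : ∀ d : ℕ, Measurable fun z : Fin d → ℝ => ∑ i, z i ^ 2 := fun d => by fun_prop
  rw [noncentralChiSq, chiSq, Measure.map_prod_map _ _ (hmeas _) (hmeas _), ← hmU, ← hmW,
    ← hpair, AEMeasurable.map_map_of_aemeasurable
      (((hmeas _).prodMap (hmeas _)).aemeasurable) hg.aemeasurable]
  congr 1

/-- If `Y` is a Gaussian vector with covariance `V`, and the ranges of two orthogonal projections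
are orthogonal eigenspaces of `V` for one and the same eigenvalue, then the ratio of the mean
squares of the projections of `Y` has a noncentral `F`-distribution. -/
lemma hasLaw_noncentralF_of_gaussian {Ω ι : Type*} [Fintype ι] [DecidableEq ι]
    [MeasurableSpace Ω] {P : Measure Ω} [IsProbabilityMeasure P] {Y : Ω → ι → ℝ}
    (hY : HasGaussianLaw Y P) {m : ι → ℝ} (hm : ∀ o, ∫ ω, Y ω o ∂P = m o)
    {V : Matrix ι ι ℝ}
    (hV : ∀ o o', covariance (fun ω => Y ω o) (fun ω => Y ω o') P = V o o')
    {Q₁ Q₂ : Matrix ι ι ℝ} (hs₁ : Q₁.transpose = Q₁) (hs₂ : Q₂.transpose = Q₂)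
    (hi₁ : Q₁ * Q₁ = Q₁) (hi₂ : Q₂ * Q₂ = Q₂) (h₁₂ : Q₁ * Q₂ = 0)
    {c : ℝ} (hc : 0 < c) (hV₁ : V * Q₁ = c • Q₁) (hV₂ : V * Q₂ = c • Q₂)
    (hm₂ : Q₂.mulVec m = 0) {d₁ d₂ : ℕ} (hd₁ : Q₁.trace = d₁) (hd₂ : Q₂.trace = d₂) :
    HasLaw (fun ω => ((∑ o, Q₁.mulVec (Y ω) o ^ 2) / (d₁ : ℝ)) /
        ((∑ o, Q₂.mulVec (Y ω) o ^ 2) / (d₂ : ℝ)))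
      (noncentralF d₁ d₂ ((∑ o, Q₁.mulVec m o ^ 2) / c)) P := by
  obtain ⟨u, hu, huo, hus, hum⟩ := exists_orthonormal_frame hs₁ hi₁ hd₁ m
  obtain ⟨v, hv, hvo, hvs, hvm⟩ := exists_orthonormal_frame hs₂ hi₂ hd₂ m
  have hYo : ∀ o, MemLp (fun ω => Y ω o) 2 P := fun o => (hY.eval o).memLp_two
  -- dividing by `√c` gives the coordinates unit variances
  obtain ⟨L, hL⟩ : ∃ L : (ι → ℝ) → (ι → ℝ) →L[ℝ] ℝ, ∀ x y, L x y = (√c)⁻¹ * (x ⬝ᵥ y) :=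
    ⟨fun x => (√c)⁻¹ • ∑ o, x o • ContinuousLinearMap.proj (R := ℝ) (φ := fun _ : ι => ℝ) o,
      fun x y => by simp [dotProduct]⟩
  let U : Fin d₁ → Ω → ℝ := fun k ω => L (u k) (Y ω)
  let W : Fin d₂ → Ω → ℝ := fun k ω => L (v k) (Y ω)
  have hcov : ∀ x z, covariance (fun ω => L x (Y ω)) (fun ω => L z (Y ω)) P
      = c⁻¹ * (x ⬝ᵥ V.mulVec z) := by
    intro x z
    simp only [hL]
    rw [covariance_const_mul_left, covariance_const_mul_right, covariance_dotProduct hYo hV,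
      ← mul_assoc, ← mul_inv, Real.mul_self_sqrt hc.le]
  have hmean : ∀ x, ∫ ω, L x (Y ω) ∂P = (√c)⁻¹ * (x ⬝ᵥ m) := by
    intro x
    simp only [hL, dotProduct]
    rw [integral_const_mul, integral_finsetSum _
      (fun o _ => ((hYo o).integrable (by norm_num)).const_mul _)]
    simp only [integral_const_mul, hm]
  have heig : ∀ {Q : Matrix ι ι ℝ}, V * Q = c • Q → ∀ x, Q.mulVec x = x →
      V.mulVec x = c • x := by
    intro Q hQ x hx
    conv_lhs => rw [← hx]
    rw [Matrix.mulVec_mulVec, hQ, Matrix.smul_mulVec, hx]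
  have hUU : ∀ k l, covariance (U k) (U l) P = if k = l then 1 else 0 := by
    intro k l
    simp only [U]
    rw [hcov, heig hV₁ _ (hu l), dotProduct_smul, huo, smul_eq_mul,
      inv_mul_cancel_left₀ hc.ne']
  have hWW : ∀ k l, covariance (W k) (W l) P = if k = l then 1 else 0 := by
    intro k l
    simp only [W]
    rw [hcov, heig hV₂ _ (hv l), dotProduct_smul, hvo, smul_eq_mul,
      inv_mul_cancel_left₀ hc.ne']
  have horth : ∀ k l, u k ⬝ᵥ v l = 0 := by
    intro k l
    rw [← hu k, ← Matrix.vecMul_transpose, hs₁, ← Matrix.dotProduct_mulVec, ← hv l,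
      Matrix.mulVec_mulVec, h₁₂, Matrix.zero_mulVec, dotProduct_zero]
  have hUW : ∀ k l, covariance (U k) (W l) P = 0 := by
    intro k l
    simp only [U, W]
    rw [hcov, heig hV₂ _ (hv l), dotProduct_smul, horth, smul_zero, mul_zero]
  have hvm0 : ∀ l, v l ⬝ᵥ m = 0 := by
    intro l
    rw [← hv l, ← Matrix.vecMul_transpose, hs₂, ← Matrix.dotProduct_mulVec, hm₂,
      dotProduct_zero]
  have hgUW : HasGaussianLaw (fun ω => (fun k => U k ω, fun k => W k ω)) P :=
    hY.map_fun ((ContinuousLinearMap.pi fun k => L (u k)).prod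
      (ContinuousLinearMap.pi fun k => L (v k)))
  have hprod : P.map (fun ω => (∑ k, U k ω ^ 2, ∑ k, W k ω ^ 2)) =
      (noncentralChiSq d₁ ((∑ o, Q₁.mulVec m o ^ 2) / c)).prod (chiSq d₂) := by
    refine map_sum_sq_of_gaussian hgUW (fun k => ?_) (fun k => ?_) hUU hWW hUW
    · simp only [U]
      rw [hmean, hum]
      split_ifs
      · rw [Real.sqrt_div' _ hc.le, inv_mul_eq_div]
      · simp
    · simp only [W]
      rw [hmean, hvm0, mul_zero]
  have hq : Measurable fun p : ℝ × ℝ => (p.1 / (d₁ : ℝ)) / (p.2 / (d₂ : ℝ)) := by fun_prop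
  have hUm : ∀ k, AEMeasurable (U k) P := fun k => (hY.map_fun (L (u k))).aemeasurable
  have hWm : ∀ k, AEMeasurable (W k) P := fun k => (hY.map_fun (L (v k))).aemeasurable
  have hUWm : AEMeasurable (fun ω => (∑ k, U k ω ^ 2, ∑ k, W k ω ^ 2)) P :=
    (Finset.aemeasurable_fun_sum _ fun k _ => (hUm k).pow_const 2).prodMk
      (Finset.aemeasurable_fun_sum _ fun k _ => (hWm k).pow_const 2)
  have heq : (fun ω => ((∑ o, Q₁.mulVec (Y ω) o ^ 2) / (d₁ : ℝ)) /
        ((∑ o, Q₂.mulVec (Y ω) o ^ 2) / (d₂ : ℝ))) =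
      (fun p : ℝ × ℝ => (p.1 / (d₁ : ℝ)) / (p.2 / (d₂ : ℝ))) ∘
        fun ω => (∑ k, U k ω ^ 2, ∑ k, W k ω ^ 2) := by
    funext ω
    have hS : ∀ {d : ℕ} (x : Fin d → ι → ℝ),
        ∑ k, (L (x k) (Y ω)) ^ 2 = c⁻¹ * ∑ k, (x k ⬝ᵥ Y ω) ^ 2 := by
      intro d x
      rw [Finset.mul_sum]
      refine Finset.sum_congr rfl fun k _ => ?_
      rw [hL, mul_pow, inv_pow, Real.sq_sqrt hc.le]
    simp only [Function.comp_apply, U, W, hS, hus, hvs]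
    rw [mul_div_assoc c⁻¹ (∑ k, (u k ⬝ᵥ Y ω) ^ 2), mul_div_assoc c⁻¹ (∑ k, (v k ⬝ᵥ Y ω) ^ 2),
      mul_div_mul_left _ _ (inv_ne_zero hc.ne')]
  rw [heq]
  refine ⟨hq.comp_aemeasurable hUWm, ?_⟩
  rw [← AEMeasurable.map_map_of_aemeasurable hq.aemeasurable hUWm, hprod, noncentralF]

/-! ### Tensor products of averaging and centering -/

/-- The `m × m` matrix acting as `a` on vectors with zero sum and as `b` on constant vectors. -/
noncomputable def levelKernel {m : ℕ} (a b : ℝ) (i j : Fin m) : ℝ :=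
  a * ((if i = j then 1 else 0) - 1 / m) + b * (1 / m)

lemma levelKernel_comm {m : ℕ} (a b : ℝ) (i j : Fin m) :
    levelKernel a b i j = levelKernel a b j i := by
  simp only [levelKernel, eq_comm]

lemma levelKernel_zero_left {m : ℕ} (b : ℝ) (i j : Fin m) :
    levelKernel 0 b i j = b * (1 / m) := by
  simp [levelKernel]

lemma levelKernel_one_one {m : ℕ} (i j : Fin m) :
    levelKernel 1 1 i j = if i = j then 1 else 0 := by
  simp [levelKernel]

lemma levelKernel_smul {m : ℕ} (c a b : ℝ) (i j : Fin m) :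
    levelKernel (c * a) (c * b) i j = c * levelKernel a b i j := by
  simp only [levelKernel]; ring

lemma sum_levelKernel {m : ℕ} (a b : ℝ) (i : Fin m) : ∑ j, levelKernel a b i j = b := by
  have hm : (m : ℝ) ≠ 0 := Nat.cast_ne_zero.2 i.pos.ne'
  simp only [levelKernel, Finset.sum_add_distrib, ← Finset.mul_sum, Finset.sum_sub_distrib]
  simp [hm]

lemma sum_levelKernel_self {m : ℕ} (hm : 1 ≤ m) (a b : ℝ) :
    ∑ i : Fin m, levelKernel a b i i = a * (m - 1) + b := by
  have hm : (m : ℝ) ≠ 0 := Nat.cast_ne_zero.2 (by lia)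
  simp [levelKernel]
  field_simp

lemma sum_levelKernel_mul {m : ℕ} (a b a' b' : ℝ) (i k : Fin m) :
    ∑ j, levelKernel a b i j * levelKernel a' b' j k = levelKernel (a * a') (b * b') i k := by
  have hm : (m : ℝ) ≠ 0 := Nat.cast_ne_zero.2 i.pos.ne'
  have h1 : ∑ j, levelKernel a b i j * ((b' - a') * (1 / m)) = b * ((b' - a') * (1 / m)) := by
    rw [← Finset.sum_mul, sum_levelKernel]
  have h2 : ∑ j, levelKernel a b i j * (a' * if j = k then 1 else 0) = levelKernel a b i k * a' := by
    simp
  -- the second matrix is `a'` times the identity plus a constant matrix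
  have h3 : ∀ j, levelKernel a b i j * levelKernel a' b' j k =
      levelKernel a b i j * ((b' - a') * (1 / m)) +
        levelKernel a b i j * (a' * if j = k then 1 else 0) := by
    intro j
    rw [← mul_add]
    congr 1
    simp only [levelKernel]; ring
  rw [Finset.sum_congr rfl fun j _ => h3 j, Finset.sum_add_distrib, h1, h2]
  simp only [levelKernel]; ring

namespace Model

variable {M : Model} {lev : Factor → ℕ} {n : ℕ}

/-- The tensor product of the matrices `levelKernel (p f) (q f)` over the factors `f` of the model
and of `levelKernel r s` over the replicates, as a matrix on the observations. -/
noncomputable def kernel (M : Model) (lev : Factor → ℕ) (n : ℕ) (p q : Factor → ℝ) (r s : ℝ) :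
    Matrix (Obs M lev n) (Obs M lev n) ℝ :=
  fun o o' => (∏ f : ↥M.factors, levelKernel (p f) (q f) (o.1 f) (o'.1 f)) *
    levelKernel r s o.2 o'.2

lemma kernel_transpose (p q : Factor → ℝ) (r s : ℝ) :
    (kernel M lev n p q r s).transpose = kernel M lev n p q r s := by
  ext o o'
  simp only [Matrix.transpose_apply, kernel]
  rw [levelKernel_comm, Finset.prod_congr rfl fun f _ => levelKernel_comm _ _ _ _]

lemma kernel_congr {p q p' q' : Factor → ℝ} (hp : ∀ f ∈ M.factors, p f = p' f)
    (hq : ∀ f ∈ M.factors, q f = q' f) (r s : ℝ) :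
    kernel M lev n p q r s = kernel M lev n p' q' r s := by
  ext o o'
  simp only [kernel]
  rw [Finset.prod_congr rfl fun f _ => by rw [hp f f.2, hq f f.2]]

lemma kernel_eq_zero {p q : Factor → ℝ} {f : Factor} (hf : f ∈ M.factors) (hp : p f = 0)
    (hq : q f = 0) (r s : ℝ) : kernel M lev n p q r s = 0 := by
  ext o o'
  simp only [kernel, Matrix.zero_apply]
  rw [Finset.prod_eq_zero (Finset.mem_univ ⟨f, hf⟩), zero_mul]
  simp [hp, hq, levelKernel]

lemma kernel_zero_zero (p q : Factor → ℝ) : kernel M lev n p q 0 0 = 0 := by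
  ext o o'
  simp [kernel, levelKernel]

lemma kernel_smul (c p q : Factor → ℝ) (t r s : ℝ) :
    kernel M lev n (c * p) (c * q) (t * r) (t * s) =
      ((∏ f ∈ M.factors, c f) * t) • kernel M lev n p q r s := by
  ext o o'
  simp only [kernel, Matrix.smul_apply, smul_eq_mul, Pi.mul_apply, levelKernel_smul]
  rw [Finset.prod_mul_distrib, ← Finset.prod_coe_sort M.factors c]
  ring

/-- Summing a product of functions of the single subscripts over all observations. -/
lemma sum_obs_prod (F : (f : ↥M.factors) → Fin (lev f) → ℝ) (G : Fin n → ℝ) :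
    ∑ o : Obs M lev n, (∏ f, F f (o.1 f)) * G o.2 = (∏ f, ∑ j, F f j) * ∑ k, G k := by
  rw [Fintype.sum_prod_type]
  simp only [← Finset.mul_sum, ← Finset.sum_mul]
  rw [Finset.prod_univ_sum, Fintype.piFinset_univ]

lemma kernel_mul (p q p' q' : Factor → ℝ) (r s r' s' : ℝ) :
    kernel M lev n p q r s * kernel M lev n p' q' r' s' =
      kernel M lev n (p * p') (q * q') (r * r') (s * s') := by
  ext o o'
  simp only [Matrix.mul_apply, kernel, Pi.mul_apply]
  simp only [← sum_levelKernel_mul]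
  rw [← sum_obs_prod]
  refine Finset.sum_congr rfl fun x _ => ?_
  rw [Finset.prod_mul_distrib]
  ring

lemma sum_kernel (p q : Factor → ℝ) (r s : ℝ) (o : Obs M lev n) :
    ∑ o', kernel M lev n p q r s o o' = (∏ f ∈ M.factors, q f) * s := by
  simp only [kernel]
  rw [sum_obs_prod (fun f j => levelKernel (p f) (q f) (o.1 f) j) (fun k => levelKernel r s o.2 k)]
  simp only [sum_levelKernel]
  rw [← Finset.prod_coe_sort M.factors q]

lemma trace_kernel (hlev : ∀ f ∈ M.factors, 1 ≤ lev f) (hn : 1 ≤ n) (p q : Factor → ℝ) (r s : ℝ) :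
    (kernel M lev n p q r s).trace =
      (∏ f ∈ M.factors, (p f * (lev f - 1) + q f)) * (r * (n - 1) + s) := by
  simp only [Matrix.trace, Matrix.diag, kernel]
  rw [sum_obs_prod (fun f j => levelKernel (p f) (q f) j j) (fun k => levelKernel r s k k),
    sum_levelKernel_self hn,
    ← Finset.prod_coe_sort M.factors (fun f => p f * ((lev f : ℝ) - 1) + q f)]
  congr 1
  exact Finset.prod_congr rfl fun f _ => sum_levelKernel_self (hlev f f.2) _ _

lemma kernel_one : kernel M lev n 1 1 1 1 = 1 := by
  ext o o'
  simp only [kernel, Pi.one_apply, levelKernel_one_one, Matrix.one_apply, Fintype.prod_boole]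
  simp [Prod.ext_iff, funext_iff, ← ite_and, and_comm]

/-- The kernel is affine in the weights of each single factor: deleting the constant part at `f`
amounts to subtracting the average over the levels of `f`. -/
lemma kernel_sub {p q p' q' p'' q'' : Factor → ℝ} {f : Factor} (hf : f ∈ M.factors)
    (hp : p f = p' f - p'' f) (hq : q f = q' f - q'' f)
    (hp' : ∀ g, g ≠ f → p g = p' g ∧ p g = p'' g) (hq' : ∀ g, g ≠ f → q g = q' g ∧ q g = q'' g)
    (r s : ℝ) :
    kernel M lev n p q r s = kernel M lev n p' q' r s - kernel M lev n p'' q'' r s := by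
  ext o o'
  simp only [kernel, Matrix.sub_apply]
  rw [← sub_mul]
  congr 1
  have hsplit := fun F : ↥M.factors → ℝ =>
    (Finset.mul_prod_erase Finset.univ F (Finset.mem_univ ⟨f, hf⟩)).symm
  rw [hsplit, hsplit (fun g => levelKernel (p' g) _ _ _),
    hsplit (fun g => levelKernel (p'' g) _ _ _)]
  have h1 : ∀ g ∈ Finset.univ.erase (⟨f, hf⟩ : ↥M.factors), (g : Factor) ≠ f := fun g hg h =>
    (Finset.mem_erase.1 hg).1 (Subtype.ext h)
  have h2 : ∀ g ∈ Finset.univ.erase (⟨f, hf⟩ : ↥M.factors), levelKernel (p' g) (q' g) (o.1 g)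
      (o'.1 g) = levelKernel (p g) (q g) (o.1 g) (o'.1 g) := fun g hg => by
    rw [(hp' g (h1 g hg)).1, (hq' g (h1 g hg)).1]
  have h3 : ∀ g ∈ Finset.univ.erase (⟨f, hf⟩ : ↥M.factors), levelKernel (p'' g) (q'' g) (o.1 g)
      (o'.1 g) = levelKernel (p g) (q g) (o.1 g) (o'.1 g) := fun g hg => by
    rw [(hp' g (h1 g hg)).2, (hq' g (h1 g hg)).2]
  rw [Finset.prod_congr rfl h2, Finset.prod_congr rfl h3, ← sub_mul]
  congr 1
  simp only [hp, hq, levelKernel]; ring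

/-- The indicator function of a set of factors. -/
noncomputable def ind (D : Finset Factor) (f : Factor) : ℝ := if f ∈ D then 1 else 0

lemma mean_eq_kernel (D : Finset Factor) (y : Obs M lev n → ℝ) (o : Obs M lev n) :
    M.mean lev n D y o = (kernel M lev n (ind D) 1 0 1).mulVec y o := by
  set s := Finset.univ.filter fun o' : Obs M lev n =>
    ∀ f : ↥M.factors, (f : Factor) ∈ D → o'.1 f = o.1 f with hs
  set κ : ℝ := (∏ f : ↥M.factors, if (f : Factor) ∈ D then (1 : ℝ) else 1 / lev f) * (1 / n)
  have hk : ∀ o', kernel M lev n (ind D) 1 0 1 o o' = if o' ∈ s then κ else 0 := by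
    intro o'
    simp only [kernel, Pi.one_apply, levelKernel_zero_left, one_mul, κ]
    split_ifs with ho
    · congr 1
      refine Finset.prod_congr rfl fun f _ => ?_
      by_cases hf : (f : Factor) ∈ D
      · have := (Finset.mem_filter.1 ho).2 f hf
        simp [ind, hf, levelKernel_one_one, this]
      · simp [ind, hf, levelKernel_zero_left]
    · rw [hs, Finset.mem_filter] at ho
      push Not at ho
      obtain ⟨f, hf, hne⟩ := ho (Finset.mem_univ _)
      rw [Finset.prod_eq_zero (Finset.mem_univ f), zero_mul]
      simp [ind, hf, levelKernel_one_one, hne.symm]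
  -- the rows of the averaging kernel sum to one, which determines the constant `κ`
  have hrow := sum_kernel (M := M) (lev := lev) (n := n) (ind D) 1 0 1 o
  simp only [hk, Finset.sum_ite_mem, Finset.univ_inter, Finset.sum_const, nsmul_eq_mul,
    Pi.one_apply, Finset.prod_const_one, one_mul] at hrow
  have hκ : κ = (s.card : ℝ)⁻¹ := (eq_inv_of_mul_eq_one_right hrow)
  simp only [Matrix.mulVec, dotProduct, hk, ite_mul, zero_mul, Finset.sum_ite_mem,
    Finset.univ_inter, ← Finset.mul_sum]
  rw [hκ, inv_mul_eq_div]
  rfl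

lemma live_subset (M : Model) (D : Finset Factor) : M.live D ⊆ D := Finset.filter_subset _ _

/-- The orthogonal projection onto the space of the effects of the term `D`: the identity over the
nesting factors of the term, centering over the live factors, averaging over everything else. -/
noncomputable def proj (M : Model) (lev : Factor → ℕ) (n : ℕ) (D : Finset Factor) :
    Matrix (Obs M lev n) (Obs M lev n) ℝ :=
  kernel M lev n (ind D) (1 - ind (M.live D)) 0 1

/-- The orthogonal projection onto the within-cell deviations. -/
noncomputable def residualProj (M : Model) (lev : Factor → ℕ) (n : ℕ) :
    Matrix (Obs M lev n) (Obs M lev n) ℝ :=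
  kernel M lev n 1 1 1 0

/-- Centering over one more factor of `D`. -/
lemma kernel_insert {D L : Finset Factor} {f : Factor} (hD : D ⊆ M.factors) (hf : f ∈ D)
    (r s : ℝ) :
    kernel M lev n (ind D) (1 - ind (insert f L)) r s =
      kernel M lev n (ind D) (1 - ind L) r s - kernel M lev n (ind (D.erase f)) (1 - ind L) r s := by
  refine kernel_sub (hD hf) ?_ ?_ (fun g hg => ?_) (fun g hg => ?_) r s
  · simp [ind, hf]
  · simp [ind]
  · simp [ind, hg]
  · simp [ind, hg]

/-- The inclusion-exclusion sum over sets of live factors, which defines the estimates, factorizes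
into centering over each live factor. -/
lemma sum_powerset_kernel {D L : Finset Factor} (hD : D ⊆ M.factors) (hL : L ⊆ D) :
    ∑ K ∈ L.powerset, (-1 : ℝ) ^ K.card • kernel M lev n (ind (D \ K)) 1 0 1 =
      kernel M lev n (ind D) (1 - ind L) 0 1 := by
  induction L using Finset.induction generalizing D with
  | empty =>
    have : (1 : Factor → ℝ) - ind ∅ = 1 := by funext f; simp [ind]
    simp [this]
  | insert f L hf ih =>
    have hLD : L ⊆ D := (Finset.subset_insert _ _).trans hL
    have hfD : f ∈ D := hL (Finset.mem_insert_self _ _)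
    rw [Finset.sum_powerset_insert hf, ih hD hLD, kernel_insert hD hfD,
      sub_eq_add_neg (kernel M lev n (ind D) (1 - ind L) 0 1)]
    congr 1
    rw [← ih ((Finset.erase_subset _ _).trans hD)
      (fun g hg => Finset.mem_erase.2 ⟨fun h : g = f => hf (h ▸ hg), hLD hg⟩),
      ← Finset.sum_neg_distrib]
    refine Finset.sum_congr rfl fun K hK => ?_
    have hfK : f ∉ K := fun h => hf (Finset.mem_powerset.1 hK h)
    rw [Finset.card_insert_of_notMem hfK, pow_succ, mul_neg_one, neg_smul,
      Finset.sdiff_insert, Finset.erase_sdiff_comm]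

lemma estimate_eq_proj {D : Finset Factor} (hD : D ⊆ M.factors) (y : Obs M lev n → ℝ)
    (o : Obs M lev n) : M.estimate lev n D y o = (proj M lev n D).mulVec y o := by
  rw [proj, ← sum_powerset_kernel hD (live_subset M D), Matrix.sum_mulVec, Finset.sum_apply,
    estimate]
  refine Finset.sum_congr rfl fun K _ => ?_
  rw [mean_eq_kernel, Matrix.smul_mulVec]
  rfl

lemma residual_eq_proj (y : Obs M lev n → ℝ) (o : Obs M lev n) :
    y o - M.mean lev n M.factors y o = (residualProj M lev n).mulVec y o := by
  have h1 : residualProj M lev n = 1 - kernel M lev n (ind M.factors) 1 0 1 := by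
    rw [← kernel_one, kernel_congr (p := ind M.factors) (p' := 1) (q' := 1)
      (fun f hf => by simp [ind, hf]) (fun _ _ => rfl)]
    ext o o'
    simp only [residualProj, kernel, Matrix.sub_apply, ← mul_sub]
    congr 1
    simp only [levelKernel]; ring
  rw [h1, Matrix.sub_mulVec, Matrix.one_mulVec, mean_eq_kernel]
  rfl

lemma proj_transpose (D : Finset Factor) : (proj M lev n D).transpose = proj M lev n D :=
  kernel_transpose _ _ _ _

lemma residualProj_transpose : (residualProj M lev n).transpose = residualProj M lev n :=
  kernel_transpose _ _ _ _

lemma proj_mul_self (D : Finset Factor) : proj M lev n D * proj M lev n D = proj M lev n D := by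
  rw [proj, kernel_mul]
  have h1 : ind D * ind D = ind D := by funext f; simp [ind]
  have h2 : (1 - ind (M.live D)) * (1 - ind (M.live D)) = 1 - ind (M.live D) := by
    funext f; by_cases h : f ∈ M.live D <;> simp [ind, h]
  rw [h1, h2, mul_zero, mul_one]

lemma residualProj_mul_self :
    residualProj M lev n * residualProj M lev n = residualProj M lev n := by
  simp [residualProj, kernel_mul]

lemma proj_mul_residualProj (D : Finset Factor) : proj M lev n D * residualProj M lev n = 0 := by
  simp [residualProj, proj, kernel_mul, kernel_zero_zero]

lemma trace_proj (hlev : ∀ f ∈ M.factors, 1 ≤ lev f) (hn : 1 ≤ n) {D : Finset Factor}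
    (hD : D ⊆ M.factors) : (proj M lev n D).trace = M.dof lev D := by
  rw [proj, trace_kernel hlev hn, dof, ← Finset.prod_subset hD]
  · push_cast
    rw [zero_mul, zero_add, mul_one]
    refine Finset.prod_congr rfl fun f hf => ?_
    by_cases h : f ∈ M.live D
    · simp [ind, hf, h, Nat.cast_sub (hlev f (hD hf))]
    · simp [ind, hf, h]
  · intro f _ hf
    have : f ∉ M.live D := fun h => hf (live_subset M D h)
    simp [ind, hf, this]

lemma trace_residualProj (hlev : ∀ f ∈ M.factors, 1 ≤ lev f) (hn : 1 ≤ n) :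
    (residualProj M lev n).trace = (((∏ f ∈ M.factors, lev f) * (n - 1) : ℕ) : ℝ) := by
  rw [residualProj, trace_kernel hlev hn]
  push_cast [hn]
  simp

/-- The subscripts of the effect of the term `D` in an observation. -/
def restr {D : Finset Factor} (hD : D ⊆ M.factors) (o : Obs M lev n) : Idx lev D :=
  fun f => o.1 ⟨f, hD f.2⟩

/-- Averaging over the levels of `f` kills vectors with zero sum over the levels of `f`. -/
lemma kernel_mulVec_eq_zero {p q : Factor → ℝ} {r s : ℝ} (f : ↥M.factors) (hp : p f = 0)
    {g : Obs M lev n → ℝ} (hg : ∀ o : Obs M lev n, ∑ l, g (Function.update o.1 f l, o.2) = 0) :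
    (kernel M lev n p q r s).mulVec g = 0 := by
  funext o
  simp only [Matrix.mulVec, dotProduct, Pi.zero_apply]
  have hlf : (lev f : ℝ) ≠ 0 := Nat.cast_ne_zero.2 (o.1 f).pos.ne'
  refine (mul_eq_zero.1 ?_).resolve_left hlf
  set F := fun o' => kernel M lev n p q r s o o' * g o'
  -- exchanging the level of `f` with an extra level is a bijection
  have h1 : ∑ x : Obs M lev n × Fin (lev f), F (Function.update x.1.1 f x.2, x.1.2) =
      ∑ x : Obs M lev n × Fin (lev f), F x.1 := by
    refine Finset.sum_nbij' (fun x => ((Function.update x.1.1 f x.2, x.1.2), x.1.1 f))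
      (fun x => ((Function.update x.1.1 f x.2, x.1.2), x.1.1 f)) ?_ ?_ ?_ ?_ ?_ <;> simp
  have h2 : ∑ x : Obs M lev n × Fin (lev f), F x.1 = lev f * ∑ o', F o' := by
    rw [Fintype.sum_prod_type, Finset.mul_sum]
    simp
  rw [← h2, ← h1, Fintype.sum_prod_type]
  refine Finset.sum_eq_zero fun o' _ => ?_
  have h3 : ∀ l, kernel M lev n p q r s o (Function.update o'.1 f l, o'.2) =
      kernel M lev n p q r s o o' := by
    intro l
    simp only [kernel]
    congr 1
    refine Finset.prod_congr rfl fun f' _ => ?_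
    by_cases h : f' = f
    · subst h; simp [hp, levelKernel_zero_left]
    · rw [Function.update_of_ne h]
  simp only [F, h3, ← Finset.mul_sum, hg, mul_zero]

/-- Effects of the term `D` that sum to zero over each live factor lie in the range of the
projection onto the term. -/
lemma proj_mulVec_effect {D : Finset Factor} (hD : D ⊆ M.factors) {t : Idx lev D → ℝ}
    (ht : ∀ f : ↥D, (f : Factor) ∈ M.live D →
      ∀ i : Idx lev D, ∑ l : Fin (lev f), t (Function.update i f l) = 0) :
    (proj M lev n D).mulVec (fun o => t (restr hD o)) = fun o => t (restr hD o) := by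
  have main : ∀ L ⊆ M.live D, (kernel M lev n (ind D) (1 - ind L) 0 1).mulVec
      (fun o => t (restr hD o)) = fun o => t (restr hD o) := by
    intro L
    induction L using Finset.induction with
    | empty =>
      intro _
      have : (1 : Factor → ℝ) - ind ∅ = 1 := by funext f; simp [ind]
      funext o
      rw [this, ← mean_eq_kernel]
      have hconst : ∀ o' ∈ Finset.univ.filter (fun o' : Obs M lev n =>
          ∀ f : ↥M.factors, (f : Factor) ∈ D → o'.1 f = o.1 f),
          t (restr hD o') = t (restr hD o) := fun o' ho' => by
        congr 1
        funext f
        exact (Finset.mem_filter.1 ho').2 ⟨f, hD f.2⟩ f.2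
      simp only [mean]
      rw [Finset.sum_congr rfl hconst, Finset.sum_const, nsmul_eq_mul, mul_div_cancel_left₀]
      exact Nat.cast_ne_zero.2 (Finset.card_ne_zero.2 ⟨o, by simp⟩)
    | insert f L hf ih =>
      intro hL
      have hfl : f ∈ M.live D := hL (Finset.mem_insert_self _ _)
      have hfD : f ∈ D := live_subset M D hfl
      rw [kernel_insert hD hfD, Matrix.sub_mulVec, ih ((Finset.subset_insert _ _).trans hL),
        kernel_mulVec_eq_zero ⟨f, hD hfD⟩ (by simp [ind]), sub_zero]
      intro o
      rw [← ht ⟨f, hfD⟩ hfl (restr hD o)]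
      refine Finset.sum_congr rfl fun l _ => ?_
      congr 1
      funext g
      by_cases h : (g : Factor) = f
      · obtain ⟨g, hg⟩ := g
        simp only at h
        subst h
        simp [restr]
      · rw [Function.update_of_ne (fun h' => h (congrArg Subtype.val h'))]
        simp only [restr]
        rw [Function.update_of_ne (fun h' => h (congrArg Subtype.val h'))]
  exact main _ subset_rfl

/-! ### Projections and covariance matrices of the terms -/

/-- If all live factors of `E` were in `D`, then so would be all of `E`, since `D` contains all
factors that a factor of `D` is nested in. -/
lemma exists_mem_live_notMem {D E : Finset Factor} (hD : D ∈ M.terms) (hE : E ∈ M.terms)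
    (hED : ¬ E ⊆ D) : ∃ f ∈ M.live E, f ∉ D := by
  have : ∀ D ∈ M.terms, ∀ E ∈ M.terms, ¬ E ⊆ D → ∃ f ∈ M.live E, f ∉ D := by
    cases M <;> decide +kernel
  exact this D hD E hE hED

lemma proj_mul_proj {D E : Finset Factor} (hD : D ∈ M.terms) (hE : E ∈ M.terms) (hne : E ≠ D) :
    proj M lev n E * proj M lev n D = 0 := by
  rw [proj, proj, kernel_mul]
  by_cases hED : E ⊆ D
  · obtain ⟨f, hf, hfE⟩ := exists_mem_live_notMem hE hD fun h => hne (hED.antisymm h)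
    exact kernel_eq_zero (subset_of_mem_terms hD (live_subset M D hf))
      (by simp [ind, hfE]) (by simp [ind, hf]) _ _
  · obtain ⟨f, hf, hfD⟩ := exists_mem_live_notMem hD hE hED
    exact kernel_eq_zero (subset_of_mem_terms hE (live_subset M E hf))
      (by simp [ind, hfD]) (by simp [ind, hf]) _ _

lemma prod_sdiff_eq_prod_ite {K : Type*} [CommMonoid K] (s t : Finset Factor) (g : Factor → K) :
    ∏ f ∈ s \ t, g f = ∏ f ∈ s, if f ∈ t then 1 else g f := by
  rw [Finset.sdiff_eq_filter, Finset.prod_filter]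
  exact Finset.prod_congr rfl fun f _ => by split_ifs <;> simp_all

lemma proj_mulVec_const {E : Finset Factor} (hE : E ∈ M.terms) (μ : ℝ) :
    (proj M lev n E).mulVec (fun _ => μ) = 0 := by
  obtain ⟨f, hf⟩ : (M.live E).Nonempty := by
    have : ∀ E ∈ M.terms, (M.live E).Nonempty := by cases M <;> decide +kernel
    exact this E hE
  funext o
  simp only [Matrix.mulVec, dotProduct, ← Finset.sum_mul, proj]
  rw [sum_kernel, Finset.prod_eq_zero (subset_of_mem_terms hE (live_subset M E hf))]
  · simp
  · simp [ind, hf]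

lemma residualProj_mulVec_eq_zero {D : Finset Factor} (hD : D ⊆ M.factors)
    (t : Idx lev D → ℝ) :
    (residualProj M lev n).mulVec (fun o => t (restr hD o)) = 0 := by
  funext o
  rw [← residual_eq_proj, Pi.zero_apply, sub_eq_zero, mean]
  have hconst : ∀ o' ∈ Finset.univ.filter (fun o' : Obs M lev n =>
      ∀ f : ↥M.factors, (f : Factor) ∈ M.factors → o'.1 f = o.1 f),
      t (restr hD o') = t (restr hD o) := fun o' ho' => by
    congr 1
    funext f
    exact (Finset.mem_filter.1 ho').2 ⟨f, hD f.2⟩ (hD f.2)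
  rw [Finset.sum_congr rfl hconst, Finset.sum_const, nsmul_eq_mul, mul_div_cancel_left₀]
  exact Nat.cast_ne_zero.2 (Finset.card_ne_zero.2 ⟨o, by simp⟩)

/-- The weight, on constant vectors over the levels of `f`, of the covariance matrix that the
random effects of the term `D` induce on the observations. -/
noncomputable def covWeight (M : Model) (lev : Factor → ℕ) (D : Finset Factor) (ρ : Factor → ℝ)
    (f : Factor) : ℝ :=
  if f ∈ D then 1 - (if f ∈ M.live D ∧ f ∉ M.random then ρ f else 0) * lev f else lev f

lemma effectCov_eq_kernel {D : Finset Factor} (hD : D ⊆ M.factors) (s : ℝ) (ρ : Factor → ℝ)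
    (o o' : Obs M lev n) :
    M.effectCov lev D s ρ (restr hD o) (restr hD o') =
      (s • kernel M lev n (ind D) (covWeight M lev D ρ) 0 n) o o' := by
  rw [effectCov, Matrix.smul_apply, smul_eq_mul, kernel]
  have hn : (n : ℝ) ≠ 0 := Nat.cast_ne_zero.2 o.2.pos.ne'
  rw [levelKernel_zero_left, mul_one_div_cancel hn, mul_one]
  congr 1
  refine Fintype.prod_of_injective (fun f : ↥D => (⟨f, hD f.2⟩ : ↥M.factors))
    (fun f g h => Subtype.ext (Subtype.mk.inj h)) _ _ (fun f hf => ?_) fun f => ?_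
  · have hfD : (f : Factor) ∉ D := fun h => hf ⟨⟨f, h⟩, rfl⟩
    have hl : (lev f : ℝ) ≠ 0 := Nat.cast_ne_zero.2 (o.1 f).pos.ne'
    simp [ind, covWeight, hfD, levelKernel_zero_left, hl]
  · have hl : (lev f : ℝ) ≠ 0 := Nat.cast_ne_zero.2 (restr hD o f).pos.ne'
    simp only [ind, covWeight, f.2, if_true, levelKernel]
    by_cases h : restr hD o f = restr hD o' f
    · have h' : o.1 ⟨f, hD f.2⟩ = o'.1 ⟨f, hD f.2⟩ := h
      rw [if_pos h, if_pos h']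
      field_simp
      ring
    · have h' : ¬ o.1 ⟨f, hD f.2⟩ = o'.1 ⟨f, hD f.2⟩ := h
      rw [if_neg h, if_neg h']
      field_simp
      ring

/-- The random terms that contribute to the expected mean squares of the term `E`: they contain `E`,
and their live factors outside `E` are random. -/
def contributing (M : Model) (E : Finset Factor) : Finset (Finset Factor) :=
  M.randomTerms.filter fun D => E ⊆ D ∧ ∀ f ∈ M.live D, f ∉ E → f ∈ M.random

/-- The range of the projection onto the term `E` consists of eigenvectors of the covariance matrix
induced by a random term `D` whose effects sum to zero over the live fixed factors outside `E`. -/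
lemma covKernel_mul_proj (hlev : ∀ f ∈ M.factors, 1 ≤ lev f) {D E : Finset Factor}
    (hD : D ∈ M.randomTerms) (hE : E ∈ M.terms) (ρ : Factor → ℝ)
    (hρ : E ⊆ D → ∀ f ∈ M.live D, f ∉ M.random → f ∉ E → ρ f = 1 / (lev f : ℝ)) :
    kernel M lev n (ind D) (covWeight M lev D ρ) 0 n * proj M lev n E =
      if D ∈ M.contributing E then ((∏ f ∈ M.factors \ D, (lev f : ℝ)) * n) • proj M lev n E
      else 0 := by
  have hDt : D ∈ M.terms := (Finset.mem_filter.1 hD).1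
  have hDf := subset_of_mem_terms hDt
  rw [proj, kernel_mul]
  split_ifs with hc
  · obtain ⟨-, hED, hr⟩ := Finset.mem_filter.1 hc
    rw [prod_sdiff_eq_prod_ite, ← kernel_smul, mul_zero, mul_zero]
    refine kernel_congr (fun f hf => ?_) (fun f hf => ?_) _ _
    · by_cases hfE : f ∈ E
      · simp [ind, hfE, hED hfE]
      · simp [ind, hfE]
    · by_cases hfD : f ∈ D
      · by_cases hfl : f ∈ M.live E
        · simp [ind, hfl]
        · have h0 : ¬ (f ∈ M.live D ∧ f ∉ M.random) := by
            rintro ⟨h1, h2⟩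
            refine h2 (hr f h1 fun hfE => hfl ?_)
            exact Finset.mem_filter.2 ⟨hfE, fun g hg => (Finset.mem_filter.1 h1).2 g (hED hg)⟩
          simp [covWeight, hfD, h0]
      · simp [covWeight, hfD]
  · by_cases hED : E ⊆ D
    · have : ∃ f ∈ M.live D, f ∉ E ∧ f ∉ M.random := by
        by_contra h
        push Not at h
        exact hc (Finset.mem_filter.2 ⟨hD, hED, h⟩)
      obtain ⟨f, hf, hfE, hfr⟩ := this
      have hfD := live_subset M D hf
      have hl : (lev f : ℝ) ≠ 0 := Nat.cast_ne_zero.2 (by have := hlev f (hDf hfD); lia)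
      refine kernel_eq_zero (hDf hfD) (by simp [ind, hfE]) ?_ _ _
      simp [covWeight, hfD, hf, hfr, hρ hED f hf hfr hfE, hl]
    · obtain ⟨f, hf, hfD⟩ := exists_mem_live_notMem hDt hE hED
      exact kernel_eq_zero (subset_of_mem_terms hE (live_subset M E hf))
        (by simp [ind, hfD]) (by simp [ind, hf]) _ _

lemma covKernel_mul_residualProj (D : Finset Factor) (ρ : Factor → ℝ) :
    kernel M lev n (ind D) (covWeight M lev D ρ) 0 n * residualProj M lev n = 0 := by
  simp [residualProj, kernel_mul, kernel_zero_zero]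

/-- Each effect of a term occurs in equally many observations. -/
lemma sum_restr {D : Finset Factor} (hD : D ⊆ M.factors) (F : Idx lev D → ℝ) :
    ∑ o : Obs M lev n, F (restr hD o) = ((∏ f ∈ M.factors \ D, (lev f : ℝ)) * n) * ∑ i, F i := by
  have hcard : ∀ i : Idx lev D, ((Finset.univ.filter fun x : Idx lev M.factors =>
      ∀ f : ↥D, x ⟨f, hD f.2⟩ = i f).card : ℝ) = ∏ f ∈ M.factors \ D, (lev f : ℝ) := by
    intro i
    let levels : (f : ↥M.factors) → Finset (Fin (lev f)) := fun f =>
      if h : (f : Factor) ∈ D then {i ⟨f, h⟩} else Finset.univ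
    have : (Finset.univ.filter fun x : Idx lev M.factors => ∀ f : ↥D, x ⟨f, hD f.2⟩ = i f) =
        Fintype.piFinset levels := by
      ext x
      simp only [Finset.mem_filter, Finset.mem_univ, true_and, Fintype.mem_piFinset]
      constructor
      · intro h f
        simp only [levels]
        split_ifs with hf
        · exact Finset.mem_singleton.2 (h ⟨f, hf⟩)
        · exact Finset.mem_univ _
      · intro h f
        have := h ⟨f, hD f.2⟩
        simp only [levels, dif_pos f.2] at this
        exact Finset.mem_singleton.1 this
    rw [this, Fintype.card_piFinset]
    have h2 : ∀ f, (levels f).card = if (f : Factor) ∈ D then 1 else lev f := by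
      intro f
      simp only [levels]
      split_ifs <;> simp
    rw [Finset.prod_congr rfl fun f _ => h2 f,
      Finset.prod_coe_sort M.factors (fun f => if f ∈ D then 1 else lev f),
      ← prod_sdiff_eq_prod_ite, Nat.cast_prod]
  have hfib : ∀ x : Idx lev M.factors, F (fun f => x ⟨f, hD f.2⟩) =
      ∑ i, if ∀ f : ↥D, x ⟨f, hD f.2⟩ = i f then F i else 0 := by
    intro x
    rw [Finset.sum_eq_single (fun f : ↥D => x ⟨f, hD f.2⟩ : Idx lev D)]
    · simp
    · intro i _ hi
      rw [if_neg fun h => hi (funext fun f => (h f).symm)]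
    · simp
  rw [Fintype.sum_prod_type]
  have hrep : ∀ x : Idx lev M.factors, ∑ k : Fin n, F (restr (n := n) hD (x, k)) =
      n * ∑ i, if ∀ f : ↥D, x ⟨f, hD f.2⟩ = i f then F i else 0 := by
    intro x
    rw [← hfib]
    change ∑ k : Fin n, F (fun f => x ⟨f, hD f.2⟩) = _
    simp
  rw [Finset.sum_congr rfl fun x _ => hrep x, ← Finset.mul_sum, Finset.sum_comm,
    mul_comm _ (n : ℝ), mul_assoc, Finset.mul_sum (a := ∏ f ∈ M.factors \ D, (lev f : ℝ))]
  congr 1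
  refine Finset.sum_congr rfl fun i _ => ?_
  rw [← hcard i, ← Finset.sum_filter, Finset.sum_const, nsmul_eq_mul]

/-! ### The entries of the table -/

/-- The eigenvalue of the covariance matrix of the observations on the space of the term `E`. -/
noncomputable def eigenvalue (M : Model) (lev : Factor → ℕ) (n : ℕ) (σ2 : Finset Factor → ℝ≥0)
    (σ2e : ℝ≥0) (E : Finset Factor) : ℝ :=
  σ2e + ∑ D ∈ M.contributing E, (σ2 D : ℝ) * ((∏ f ∈ M.factors \ D, (lev f : ℝ)) * n)

lemma termA_mem_terms (M : Model) : M.termA ∈ M.terms := by cases M <;> decide +kernel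

lemma not_isRandomTerm_termA (M : Model) : ¬ M.IsRandomTerm M.termA := by
  cases M <;> decide +kernel

lemma A_mem_live_termA (M : Model) : A ∈ M.live M.termA := by cases M <;> decide +kernel

lemma A_mem_termA (M : Model) : A ∈ M.termA := Finset.mem_insert_self _ _

/-- The denominator in the table is a term with the same contributing random terms as `A`, hence
with equal expected mean squares under the null hypothesis. -/
lemma denominator_spec {G : Finset Factor} (hG : M.denominator = some G) :
    G ∈ M.randomTerms ∧ A ∈ G ∧ M.contributing G = M.contributing M.termA := by
  have : ∀ G ∈ M.denominator, G ∈ M.randomTerms ∧ A ∈ G ∧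
      M.contributing G = M.contributing M.termA := by
    cases M <;> decide +kernel
  exact this G hG

lemma contributing_termA_eq_empty (h : M.denominator = none) : M.contributing M.termA = ∅ := by
  revert h
  cases M <;> decide +kernel

lemma df1_eq_dof : M.df1 lev = M.dof lev M.termA := by
  cases M <;> simp [df1, dof, termA, parents, shape, Shape.parents, live] <;> ring

lemma df2_eq_residual (h : M.denominator = none) :
    M.df2 lev n = (∏ f ∈ M.factors, lev f) * (n - 1) := by
  cases M <;> simp [denominator, df2, factors, shape, Shape.factors, mul_assoc] at h ⊢

lemma df2_eq_dof {G : Finset Factor} (h : M.denominator = some G) :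
    M.df2 lev n = M.dof lev G := by
  cases M <;> simp [denominator] at h <;> subst h <;>
    simp [df2, dof, live, parents, shape, Shape.parents, mul_assoc]

lemma R_pos (hlev : ∀ f ∈ M.factors, 1 ≤ lev f) (hn : 1 ≤ n) : 0 < M.R lev n := by
  cases M <;> simp [R, factors, shape, Shape.factors, Nat.one_le_iff_ne_zero,
    Nat.pos_iff_ne_zero] at hlev hn ⊢ <;> simp [hlev, hn]


lemma contributing_termA : M.contributing M.termA =
    match M.denominator with
    | none => ∅
    | some G => if G = {A, B} ∧ C ∈ M.random then {{A, B}, {A, B, C}} else {G} := by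
  cases M <;> decide +kernel

/-- The eigenvalue on the space of `A` in terms of `R` and `T`; the product on the right is the
number of observations in which each effect of `A` occurs. -/
lemma eigenvalue_termA_mul_R (hlev : ∀ f ∈ M.factors, 1 ≤ lev f) (hn : 1 ≤ n)
    (σ2 : Finset Factor → ℝ≥0) (σ2e : ℝ≥0) :
    eigenvalue M lev n σ2 σ2e M.termA * M.R lev n =
      M.T lev n σ2 σ2e * ((∏ f ∈ M.factors \ M.termA, (lev f : ℝ)) * n) := by
  have hlev' : ∀ f ∈ M.factors, (lev f : ℝ) ≠ 0 := fun f hf =>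
    Nat.cast_ne_zero.2 (by have := hlev f hf; lia)
  have hn' : (n : ℝ) ≠ 0 := Nat.cast_ne_zero.2 (by lia)
  have h1 : ({A, B, C} : Finset Factor) ≠ {A, B} := by decide
  have h2 : ({A, C} : Finset Factor) ≠ {A, B} := by decide
  rw [eigenvalue, contributing_termA]
  simp only [prod_sdiff_eq_prod_ite]
  cases M <;> simp [denominator, random, factors, shape, Shape.factors, termA, parents,
    Shape.parents, R, T, h1, h1.symm, h2] at hlev' ⊢ <;>
    (try rcases hlev' with ⟨_, _, _⟩) <;> field_simp <;> ring

/-! ### Mean and covariance of the observations -/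


lemma subset_of_mem_randomTerms {D : Finset Factor} (hD : D ∈ M.randomTerms) : D ⊆ M.factors :=
  subset_of_mem_terms (Finset.mem_filter.1 hD).1

/-- The expectation of an observation: the general mean plus the fixed effects. -/
noncomputable def expectedResponse (μ : ℝ) (θ : (D : Finset Factor) → Idx lev D → ℝ)
    (o : Obs M lev n) : ℝ :=
  μ + ∑ D : ↥M.terms, if M.IsRandomTerm D then 0 else θ D (restr (subset_of_mem_terms D.2) o)

/-- The sum of the random effects and of the error in an observation. -/
noncomputable def deviation {Ω : Type*} (X : (D : Finset Factor) → Idx lev D → Ω → ℝ)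
    (ε : Obs M lev n → Ω → ℝ) (ω : Ω) (o : Obs M lev n) : ℝ :=
  ∑ D : ↥M.randomTerms, X D (restr (subset_of_mem_randomTerms D.2) o) ω + ε o ω

lemma response_eq {Ω : Type*} (μ : ℝ) (θ : (D : Finset Factor) → Idx lev D → ℝ)
    (X : (D : Finset Factor) → Idx lev D → Ω → ℝ) (ε : Obs M lev n → Ω → ℝ) (ω : Ω)
    (o : Obs M lev n) :
    response μ θ X ε ω o = deviation X ε ω o + expectedResponse μ θ o := by
  let g : Finset Factor → ℝ := fun D => if h : D ⊆ M.factors then X D (restr h o) ω else 0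
  have hg : ∀ D (h : D ⊆ M.factors), X D (restr h o) ω = g D := fun D h => by simp [g, h]
  have h1 : ∑ D : ↥M.randomTerms, X D (restr (subset_of_mem_randomTerms D.2) o) ω =
      ∑ D ∈ M.terms, if M.IsRandomTerm D then g D else 0 := by
    simp only [hg]
    rw [Finset.sum_coe_sort M.randomTerms g, randomTerms, Finset.sum_filter]
  rw [response, deviation, expectedResponse, h1, ← Finset.sum_coe_sort M.terms]
  have h2 : ∀ D : ↥M.terms, (if M.IsRandomTerm D.1 then
        X D.1 (restr (subset_of_mem_terms D.2) o) ω else θ D.1 (restr (subset_of_mem_terms D.2) o)) =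
      (if M.IsRandomTerm D.1 then g D else 0) +
        if M.IsRandomTerm D.1 then 0 else θ D.1 (restr (subset_of_mem_terms D.2) o) := by
    intro D
    rw [hg]
    split_ifs <;> simp
  have h3 := Finset.sum_congr (s₁ := (Finset.univ : Finset ↥M.terms)) rfl fun D _ => h2 D
  rw [Finset.sum_add_distrib] at h3
  refine Eq.trans (congrArg (fun x => μ + x + ε o ω) h3) ?_
  ring

/-- The covariance matrix of the observations. -/
noncomputable def covMatrix (M : Model) (lev : Factor → ℕ) (n : ℕ) (σ2 : Finset Factor → ℝ≥0)
    (σ2e : ℝ≥0) (ρ : Finset Factor → Factor → ℝ) : Matrix (Obs M lev n) (Obs M lev n) ℝ :=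
  ∑ D ∈ M.randomTerms, (σ2 D : ℝ) • kernel M lev n (ind D) (covWeight M lev D (ρ D)) 0 n +
    (σ2e : ℝ) • 1

lemma covMatrix_mul_residualProj (σ2 : Finset Factor → ℝ≥0) (σ2e : ℝ≥0)
    (ρ : Finset Factor → Factor → ℝ) :
    covMatrix M lev n σ2 σ2e ρ * residualProj M lev n = (σ2e : ℝ) • residualProj M lev n := by
  rw [covMatrix, add_mul, Finset.sum_mul, Finset.sum_eq_zero, zero_add, Matrix.smul_mul, one_mul]
  intro D _
  rw [Matrix.smul_mul, covKernel_mul_residualProj, smul_zero]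

section Assumptions

variable {Ω : Type*} [MeasurableSpace Ω] {P : Measure Ω}
  {σ2 : Finset Factor → ℝ≥0} {σ2e : ℝ≥0} {ρ : Finset Factor → Factor → ℝ}
  {θ : (D : Finset Factor) → Idx lev D → ℝ} {X : (D : Finset Factor) → Idx lev D → Ω → ℝ}
  {ε : Obs M lev n → Ω → ℝ}

lemma covMatrix_mul_proj (h : M.Assumptions lev n P σ2 σ2e ρ θ X ε)
    (hlev : ∀ f ∈ M.factors, 1 ≤ lev f) {E : Finset Factor} (hE : E ∈ M.terms) (hA : A ∈ E) :
    covMatrix M lev n σ2 σ2e ρ * proj M lev n E =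
      eigenvalue M lev n σ2 σ2e E • proj M lev n E := by
  rw [covMatrix, add_mul, Finset.sum_mul, Matrix.smul_mul, one_mul, eigenvalue, add_smul, add_comm,
    Finset.sum_smul]
  congr 1
  rw [contributing, Finset.sum_filter]
  refine Finset.sum_congr rfl fun D hD => ?_
  rw [Matrix.smul_mul, covKernel_mul_proj hlev hD hE (ρ D) fun hED f hf hfr hfE =>
    h.restricted D hD (hED hA) f hf hfr fun hfA => hfE (hfA ▸ hA)]
  simp only [contributing, Finset.mem_filter, hD, true_and]
  split_ifs
  · rw [smul_smul]
  · rw [smul_zero]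

lemma hasGaussianLaw_deviation (h : M.Assumptions lev n P σ2 σ2e ρ θ X ε) :
    HasGaussianLaw (deviation X ε) P := by
  have hX : HasGaussianLaw (fun ω (D : ↥M.randomTerms) i => X D.1 i ω) P :=
    h.effects_indep.hasGaussianLaw fun D => h.normal D.1 D.2
  have hε : HasGaussianLaw (fun ω o => ε o ω) P :=
    h.error_indep.hasGaussianLaw fun o => (h.error_law o).hasGaussianLaw
  have hXε := h.effects_error_indep.hasGaussianLaw hX hε
  let L : (((D : ↥M.randomTerms) → Idx lev D.1 → ℝ) × (Obs M lev n → ℝ)) →ₗ[ℝ]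
      (Obs M lev n → ℝ) :=
    { toFun := fun p o => ∑ D : ↥M.randomTerms,
        p.1 D (restr (subset_of_mem_randomTerms D.2) o) + p.2 o
      map_add' := fun p p' => by
        funext o
        simp only [Prod.fst_add, Prod.snd_add, Pi.add_apply, Finset.sum_add_distrib]
        ring
      map_smul' := fun c p => by
        funext o
        simp [Finset.mul_sum, mul_add] }
  exact hXε.map_fun (LinearMap.toContinuousLinearMap L)

lemma memLp_effect (h : M.Assumptions lev n P σ2 σ2e ρ θ X ε) {D : Finset Factor}
    (hD : D ∈ M.randomTerms) (i : Idx lev D) : MemLp (X D i) 2 P :=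
  ((h.normal D hD).eval i).memLp_two

lemma memLp_error (h : M.Assumptions lev n P σ2 σ2e ρ θ X ε) (o : Obs M lev n) :
    MemLp (ε o) 2 P :=
  (h.error_law o).hasGaussianLaw.memLp_two

lemma integral_deviation [IsProbabilityMeasure P]
    (h : M.Assumptions lev n P σ2 σ2e ρ θ X ε) (o : Obs M lev n) :
    ∫ ω, deviation X ε ω o ∂P = 0 := by
  simp only [deviation]
  have hi : ∀ D : ↥M.randomTerms, Integrable
      (fun ω => X D.1 (restr (subset_of_mem_randomTerms D.2) o) ω) P := fun D =>
    (memLp_effect h D.2 _).integrable (by norm_num)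
  rw [integral_add (integrable_finsetSum _ fun D _ => hi D)
    ((memLp_error h o).integrable (by norm_num)), integral_finsetSum _ fun D _ => hi D,
    Finset.sum_eq_zero fun D _ => h.mean_zero D.1 D.2 _, (h.error_law o).integral_eq,
    integral_id_gaussianReal, add_zero]

lemma covariance_deviation [IsProbabilityMeasure P]
    (h : M.Assumptions lev n P σ2 σ2e ρ θ X ε) (o o' : Obs M lev n) :
    covariance (fun ω => deviation X ε ω o) (fun ω => deviation X ε ω o') P =
      covMatrix M lev n σ2 σ2e ρ o o' := by
  let Z : Obs M lev n → ↥M.randomTerms → Ω → ℝ := fun o D =>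
    X D.1 (restr (subset_of_mem_randomTerms D.2) o)
  have hZ : ∀ o D, MemLp (Z o D) 2 P := fun o D => memLp_effect h D.2 _
  have hZs : ∀ o, MemLp (fun ω => ∑ D, Z o D ω) 2 P := fun o =>
    memLp_finsetSum _ fun D _ => hZ o D
  have hε := memLp_error h
  have hcross : ∀ o o', covariance (fun ω => ∑ D, Z o D ω) (ε o') P = 0 := by
    intro o o'
    refine IndepFun.covariance_eq_zero ?_ (hZs o) (hε o')
    have hφ : Measurable fun x : (D : ↥M.randomTerms) → Idx lev D.1 → ℝ =>
        ∑ D, x D (restr (subset_of_mem_randomTerms D.2) o) :=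
      Finset.measurable_fun_sum _ fun D _ => (measurable_pi_apply _).comp (measurable_pi_apply D)
    have hψ : Measurable fun y : Obs M lev n → ℝ => y o' := measurable_pi_apply o'
    exact h.effects_error_indep.comp hφ hψ
  have herr : covariance (ε o) (ε o') P = ((σ2e : ℝ) • (1 : Matrix _ _ ℝ)) o o' := by
    rw [Matrix.smul_apply, Matrix.one_apply, smul_eq_mul]
    split_ifs with hoo
    · subst hoo
      rw [covariance_self (hε o).aemeasurable, (h.error_law o).variance_eq,
        variance_id_gaussianReal, mul_one]
    · rw [(h.error_indep.indepFun hoo).covariance_eq_zero (hε o) (hε o'), mul_zero]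
  have hsum : covariance (fun ω => ∑ D, Z o D ω) (fun ω => ∑ D, Z o' D ω) P =
      (∑ D ∈ M.randomTerms, (σ2 D : ℝ) •
        kernel M lev n (ind D) (covWeight M lev D (ρ D)) 0 n) o o' := by
    rw [covariance_fun_sum_fun_sum (hZ o) (hZ o'), Matrix.sum_apply,
      ← Finset.sum_coe_sort M.randomTerms]
    refine Finset.sum_congr rfl fun D _ => ?_
    rw [Finset.sum_eq_single D]
    · rw [h.covariance D.1 D.2, effectCov_eq_kernel]
    · intro D' _ hne
      refine IndepFun.covariance_eq_zero ?_ (hZ o D) (hZ o' D')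
      have hφ : Measurable fun x : Idx lev D.1 → ℝ =>
          x (restr (subset_of_mem_randomTerms D.2) o) := measurable_pi_apply _
      have hψ : Measurable fun x : Idx lev D'.1 → ℝ =>
          x (restr (subset_of_mem_randomTerms D'.2) o') := measurable_pi_apply _
      exact (h.effects_indep.indepFun hne.symm).comp hφ hψ
    · simp
  have hdev : ∀ o, (fun ω => deviation X ε ω o) = (fun ω => ∑ D, Z o D ω) + ε o := fun o => rfl
  rw [hdev, hdev, covariance_add_left (hZs o) (hε o) ((hZs o').add (hε o')),
    covariance_add_right (hZs o) (hZs o') (hε o'), covariance_add_right (hε o) (hZs o') (hε o'),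
    hcross, covariance_comm (ε o), hcross, herr, hsum, covMatrix, Matrix.add_apply]
  ring

lemma proj_mulVec_expectedResponse (h : M.Assumptions lev n P σ2 σ2e ρ θ X ε) (μ : ℝ)
    {E : Finset Factor} (hE : E ∈ M.terms) :
    (proj M lev n E).mulVec (expectedResponse μ θ) =
      if M.IsRandomTerm E then 0 else fun o => θ E (restr (subset_of_mem_terms hE) o) := by
  have hsplit : (expectedResponse μ θ : Obs M lev n → ℝ) = (fun _ => μ) + ∑ D : ↥M.terms,
      if M.IsRandomTerm D then 0 else fun o => θ D (restr (subset_of_mem_terms D.2) o) := by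
    funext o
    simp only [expectedResponse, Pi.add_apply, Finset.sum_apply]
    congr 1
    exact Finset.sum_congr rfl fun D _ => by split_ifs <;> rfl
  have hfix : ∀ D : ↥M.terms, ¬ M.IsRandomTerm D →
      (proj M lev n D).mulVec (fun o => θ D (restr (subset_of_mem_terms D.2) o)) =
        fun o => θ D (restr (subset_of_mem_terms D.2) o) := fun D hD =>
    proj_mulVec_effect _ (h.fixed_sum D D.2 hD)
  rw [hsplit, Matrix.mulVec_add, proj_mulVec_const hE, zero_add, Matrix.mulVec_sum,
    Finset.sum_eq_single ⟨E, hE⟩]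
  · split_ifs with hr
    · exact Matrix.mulVec_zero _
    · exact hfix ⟨E, hE⟩ hr
  · intro D _ hne
    split_ifs with hr
    · exact Matrix.mulVec_zero _
    · rw [← hfix D hr, Matrix.mulVec_mulVec,
        proj_mul_proj D.2 hE (fun h => hne (Subtype.ext h.symm)), Matrix.zero_mulVec]
  · simp

lemma residualProj_mulVec_expectedResponse (μ : ℝ) (θ : (D : Finset Factor) → Idx lev D → ℝ) :
    (residualProj M lev n).mulVec (expectedResponse μ θ) = 0 := by
  funext o
  -- the mean depends on the cell only, so it is a function of all subscripts
  exact congrFun (residualProj_mulVec_eq_zero (D := M.factors) subset_rfl fun x => μ +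
    ∑ D : ↥M.terms, if M.IsRandomTerm D then 0 else
      θ D fun f => x ⟨f, subset_of_mem_terms D.2 f.2⟩) o

end Assumptions

/-- Effects of `A` with zero sums over the levels of `A` vanish under the null hypothesis. -/
lemma NoEffect.eq_zero {α : Idx lev M.termA → ℝ} (hA : lev A ≠ 0)
    (hα : ∀ i : Idx lev M.termA, ∑ l : Fin (lev A),
      α (Function.update i (⟨A, A_mem_termA M⟩ : ↥M.termA) l) = 0)
    (h : NoEffect α) (i : Idx lev M.termA) : α i = 0 := by
  have h1 : ∀ l : Fin (lev A),
      α (Function.update i (⟨A, A_mem_termA M⟩ : ↥M.termA) l) = α i := fun l =>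
    h _ _ fun f hf => Function.update_of_ne (fun h' => hf (congrArg Subtype.val h')) _ _
  have h2 := hα i
  simp only [h1, Finset.sum_const, Finset.card_univ, Fintype.card_fin, nsmul_eq_mul] at h2
  exact (mul_eq_zero.1 h2).resolve_left (Nat.cast_ne_zero.2 hA)

lemma S_pos_of_not_noEffect {α : Idx lev M.termA → ℝ} (h : ¬ NoEffect α) : 0 < S α := by
  refine lt_of_le_of_ne (Finset.sum_nonneg fun i _ => sq_nonneg _) fun h0 => h ?_
  have hz : ∀ i, α i = 0 := fun i => by
    simpa using (Finset.sum_eq_zero_iff_of_nonneg fun i _ => sq_nonneg (α i)).1 h0.symm i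
      (Finset.mem_univ i)
  intro i i' _
  rw [hz, hz]

lemma noncentralF_zero (d₁ d₂ : ℕ) : noncentralF d₁ d₂ 0 = centralF d₁ d₂ := by
  simp [noncentralF, centralF, noncentralChiSq, chiSq]

/-- The test statistic is the ratio of the mean squares of two orthogonal projections, for `A` and
for the denominator; the latter kills the mean, and its range belongs to the same eigenvalue of the
covariance matrix as the effects of `A`. -/
lemma exists_denominator_proj {Ω : Type*} [MeasurableSpace Ω] {P : Measure Ω}
    [IsProbabilityMeasure P] {σ2 : Finset Factor → ℝ≥0} {σ2e : ℝ≥0}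
    {ρ : Finset Factor → Factor → ℝ} {θ : (D : Finset Factor) → Idx lev D → ℝ}
    {X : (D : Finset Factor) → Idx lev D → Ω → ℝ} {ε : Obs M lev n → Ω → ℝ}
    (h : M.Assumptions lev n P σ2 σ2e ρ θ X ε) (hlev : ∀ f ∈ M.factors, 1 ≤ lev f) (hn : 1 ≤ n)
    (μ : ℝ) :
    ∃ Q : Matrix (Obs M lev n) (Obs M lev n) ℝ, Q.transpose = Q ∧ Q * Q = Q ∧
      proj M lev n M.termA * Q = 0 ∧
      covMatrix M lev n σ2 σ2e ρ * Q = eigenvalue M lev n σ2 σ2e M.termA • Q ∧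
      Q.mulVec (expectedResponse μ θ) = 0 ∧ Q.trace = M.df2 lev n ∧
      ∀ y, M.testStatistic lev n y =
        (∑ o, (proj M lev n M.termA).mulVec y o ^ 2) / (M.df1 lev : ℝ) /
          ((∑ o, Q.mulVec y o ^ 2) / (M.df2 lev n : ℝ)) := by
  have hA := termA_mem_terms M
  have hnum : ∀ y, M.meanSq lev n M.termA y =
      (∑ o, (proj M lev n M.termA).mulVec y o ^ 2) / (M.df1 lev : ℝ) := fun y => by
    simp only [meanSq, sumSq, estimate_eq_proj (subset_of_mem_terms hA), df1_eq_dof]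
  cases hden : M.denominator with
  | none =>
    refine ⟨residualProj M lev n, residualProj_transpose, residualProj_mul_self,
      proj_mul_residualProj _, ?_, residualProj_mulVec_expectedResponse μ θ, ?_, fun y => ?_⟩
    · rw [covMatrix_mul_residualProj, eigenvalue, contributing_termA_eq_empty hden]
      simp
    · rw [trace_residualProj hlev hn, df2_eq_residual hden]
    · rw [testStatistic, hden, hnum, df2_eq_residual hden]
      simp only [residualMeanSq, residual_eq_proj]
  | some G =>
    obtain ⟨hG, hAG, hcon⟩ := denominator_spec hden
    have hGt := (Finset.mem_filter.1 hG).1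
    have hGr := (Finset.mem_filter.1 hG).2
    refine ⟨proj M lev n G, proj_transpose _, proj_mul_self _, proj_mul_proj hGt hA ?_, ?_, ?_, ?_,
      fun y => ?_⟩
    · rintro rfl
      exact not_isRandomTerm_termA M hGr
    · rw [covMatrix_mul_proj h hlev hGt hAG, eigenvalue, hcon, eigenvalue]
    · rw [proj_mulVec_expectedResponse h μ hGt, if_pos hGr]
    · rw [trace_proj hlev hn (subset_of_mem_terms hGt), df2_eq_dof hden]
    · rw [testStatistic, hden, hnum, df2_eq_dof hden]
      simp only [meanSq, sumSq, estimate_eq_proj (subset_of_mem_terms hGt)]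

end Model

theorem theorem1 (M : Model) (lev : Factor → ℕ) (n : ℕ)
    (hA : 2 ≤ lev Factor.A) (hlev : ∀ f ∈ M.factors, 1 ≤ lev f) (hn : 1 ≤ n)
    (hdf2 : 1 ≤ M.df2 lev n)
    {Ω : Type*} [MeasurableSpace Ω] (P : Measure Ω) [IsProbabilityMeasure P]
    (σ2 : Finset Factor → ℝ≥0) (σ2e : ℝ≥0) (ρ : Finset Factor → Factor → ℝ)
    (hT : 0 < M.T lev n σ2 σ2e)
    (μ : ℝ) (θ : (D : Finset Factor) → Idx lev D → ℝ)
    (X : (D : Finset Factor) → Idx lev D → Ω → ℝ) (ε : Obs M lev n → Ω → ℝ)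
    (h : M.Assumptions lev n P σ2 σ2e ρ θ X ε) :
    HasLaw (fun ω => M.testStatistic lev n (Model.response μ θ X ε ω))
        (noncentralF (M.df1 lev) (M.df2 lev n)
          (Model.noncentrality n (θ M.termA) σ2 σ2e)) P ∧
      (Model.NoEffect (θ M.termA) →
        HasLaw (fun ω => M.testStatistic lev n (Model.response μ θ X ε ω))
          (centralF (M.df1 lev) (M.df2 lev n)) P) ∧
      (¬ Model.NoEffect (θ M.termA) →
        0 < Model.noncentrality n (θ M.termA) σ2 σ2e) := by
  have hRn : 0 < M.R lev n := Model.R_pos hlev hn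
  have hR : (0 : ℝ) < M.R lev n := Nat.cast_pos.2 hRn
  have hAt := Model.termA_mem_terms M
  have hAf := Model.subset_of_mem_terms hAt
  have hAr := Model.not_isRandomTerm_termA M
  set N : ℝ := (∏ f ∈ M.factors \ M.termA, (lev f : ℝ)) * n with hN
  have hNpos : 0 < N := mul_pos (Finset.prod_pos fun f hf =>
    Nat.cast_pos.2 (hlev f (Finset.mem_sdiff.1 hf).1)) (Nat.cast_pos.2 hn)
  set c := Model.eigenvalue M lev n σ2 σ2e M.termA
  have hcR : c * M.R lev n = M.T lev n σ2 σ2e * N :=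
    Model.eigenvalue_termA_mul_R hlev hn σ2 σ2e
  have hc : 0 < c := pos_of_mul_pos_left (hcR ▸ mul_pos hT hNpos) hR.le
  have hlaw : HasLaw (fun ω => M.testStatistic lev n (Model.response μ θ X ε ω))
      (noncentralF (M.df1 lev) (M.df2 lev n)
        (Model.noncentrality n (θ M.termA) σ2 σ2e)) P := by
    obtain ⟨Q, hQs, hQi, hAQ, hVQ, hmQ, hQt, hstat⟩ :=
      Model.exists_denominator_proj h hlev hn μ
    have hYeq : Model.response μ θ X ε =
        fun ω => Model.deviation X ε ω + Model.expectedResponse μ θ := by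
      funext ω o
      exact Model.response_eq μ θ X ε ω o
    have hYo : ∀ o, (fun ω => Model.response μ θ X ε ω o) =
        fun ω => Model.deviation X ε ω o + Model.expectedResponse μ θ o := fun o => by
      rw [hYeq]; rfl
    have hdev := Model.hasGaussianLaw_deviation h
    have hint : ∀ o, Integrable (fun ω => Model.deviation X ε ω o) P := fun o =>
      (hdev.eval o).integrable
    have hgauss : HasGaussianLaw (Model.response μ θ X ε) P := by
      have hdist := hdev.isGaussian_map
      refine ⟨?_⟩
      have hmap : P.map (Model.response μ θ X ε) =
          (P.map (Model.deviation X ε)).map (· + Model.expectedResponse μ θ) := by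
        rw [AEMeasurable.map_map_of_aemeasurable (by fun_prop) hdev.aemeasurable, hYeq]
        rfl
      rw [hmap]
      infer_instance
    have hmean : ∀ o, ∫ ω, Model.response μ θ X ε ω o ∂P = Model.expectedResponse μ θ o := by
      intro o
      rw [hYo, integral_add (hint o) (integrable_const _), Model.integral_deviation h]
      simp
    have hcov : ∀ o o', covariance (fun ω => Model.response μ θ X ε ω o)
        (fun ω => Model.response μ θ X ε ω o') P = Model.covMatrix M lev n σ2 σ2e ρ o o' := by
      intro o o'
      rw [hYo, hYo, covariance_add_const_left (hint o), covariance_add_const_right (hint o'),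
        Model.covariance_deviation h]
    have key := hasLaw_noncentralF_of_gaussian hgauss hmean hcov (Model.proj_transpose _) hQs
      (Model.proj_mul_self _) hQi hAQ hc
      (Model.covMatrix_mul_proj h hlev hAt (Model.A_mem_termA M)) hVQ hmQ
      (d₁ := M.df1 lev) (d₂ := M.df2 lev n)
      (by rw [Model.trace_proj hlev hn hAf, Model.df1_eq_dof]) hQt
    have hncp : (∑ o : Obs M lev n, (Model.proj M lev n M.termA).mulVec
        (Model.expectedResponse μ θ) o ^ 2) / c = Model.noncentrality n (θ M.termA) σ2 σ2e := by
      rw [Model.proj_mulVec_expectedResponse h μ hAt, if_neg hAr,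
        Model.sum_restr hAf fun i => θ M.termA i ^ 2, Model.noncentrality, Model.S, ← hN,
        div_eq_div_iff hc.ne' hT.ne']
      linear_combination (-∑ i, θ M.termA i ^ 2) * hcR
    rw [hncp] at key
    simp only [hstat]
    exact key
  refine ⟨hlaw, fun h0 => ?_, fun h0 => ?_⟩
  · have hz : ∀ i, θ M.termA i = 0 := h0.eq_zero (by lia)
      (h.fixed_sum M.termA hAt hAr ⟨A, Model.A_mem_termA M⟩ (Model.A_mem_live_termA M))
    have hS : Model.noncentrality n (θ M.termA) σ2 σ2e = 0 := by
      simp [Model.noncentrality, Model.S, hz]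
    rwa [hS, Model.noncentralF_zero] at hlaw
  · exact div_pos (mul_pos hR (Model.S_pos_of_not_noEffect h0)) hT
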